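/- Let $G$ be a finite abelian group of order $2^n$, $n \ge 0$. All entropies are Shannon entropies in nats. For $x, y \in [0, \log |G|]$ let $$f_G(x,y) = \min_{H(X')=x,\ H(Y')=y} H(X'+Y'),$$ the minimum being over all pairs of independent $G$-valued random variables $X', Y'$ with $H(X') = x$ and $H(Y') = y$. Let $X$, $Y$ and $Z$ be $G$-valued random variables and let $U$ be an arbitrary random variable (with values in any measurable space), all on one probability space. Suppose that $Z$ is independent of the pair $(U, X)$ and that $Y = X + Z$, where the addition is the group addition. Then $$H(Y|U) \ge f_G\bigl(H(X|U), H(Z)\bigr).$$ Here $H(X|U) = \int H(X|U=u)\, dP_U(u)$, where $H(X|U=u)$ is the entropy of the regular conditional distribution of $X$ given $U = u$; for discrete $U$ this is $\sum_u P(U=u) H(X|U=u)$. -/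

import Mathlib

open MeasureTheory ProbabilityTheory

namespace ScalarMGL

/-- The Shannon entropy, in nats, `H(p) = -∑ g, p(g) log p(g)` of a probability measure `p` on a
finite set `G` all of whose subsets are measurable; `0 log 0 = 0`. -/
noncomputable def measureEntropy {G : Type*} [Fintype G] [MeasurableSpace G]
    (p : Measure G) : ℝ :=
  ∑ g : G, Real.negMulLog (p.real {g})

/-- The entropy `H(X)` of a `G`-valued random variable `X`: the entropy of its law. -/
noncomputable def entropy {Ω G : Type*} [MeasurableSpace Ω] [Fintype G] [MeasurableSpace G]
    (X : Ω → G) (μ : Measure Ω) : ℝ :=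
  measureEntropy (μ.map X)

/-- The conditional entropy `H(X|U) = ∫ H(X | U = u) dP_U(u)` of a `G`-valued random variable `X`
given an arbitrary random variable `U`; `H(X | U = u)` is the entropy of the regular conditional
distribution of `X` given `U = u`. For discrete `U` this is `∑ u, P(U = u) H(X | U = u)`. -/
noncomputable def condEntropy {Ω 𝒰 G : Type*} [MeasurableSpace Ω] [MeasurableSpace 𝒰]
    [Fintype G] [Nonempty G] [MeasurableSpace G] [DiscreteMeasurableSpace G]
    (X : Ω → G) (U : Ω → 𝒰) (μ : Measure Ω) [IsFiniteMeasure μ] : ℝ :=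
  ∫ u, measureEntropy (condDistrib X U μ u) ∂(μ.map U)

/-- The set of all values `H(X + Y)`, where `X`, `Y` are independent `G`-valued random variables
with `H(X) = x` and `H(Y) = y`. Here `p`, `q` are the laws of `X`, `Y`, so that the convolution
`p.conv q` is the law of `X + Y`. -/
def sumEntropies (G : Type*) [AddCommGroup G] [Fintype G] [MeasurableSpace G] (x y : ℝ) : Set ℝ :=
  {h | ∃ p q : Measure G, IsProbabilityMeasure p ∧ IsProbabilityMeasure q ∧
    measureEntropy p = x ∧ measureEntropy q = y ∧ measureEntropy (p.conv q) = h}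

/-- `f_G(x, y)`, the minimum of `H(X + Y)` over independent `G`-valued `X`, `Y` with `H(X) = x` and
`H(Y) = y`. It is written as an infimum; `fG_isLeast` below shows that it is an attained minimum
for all `x, y ∈ [0, log |G|]`. -/
noncomputable def fG (G : Type*) [AddCommGroup G] [Fintype G] [MeasurableSpace G]
    (x y : ℝ) : ℝ :=
  sInf (sumEntropies G x y)

section Attained

variable {G : Type*} [Fintype G] [MeasurableSpace G]

/-- The measure on `G` with the given vector of point masses. -/
noncomputable def ofVec (v : G → ℝ) : Measure G :=
  ∑ g : G, ENNReal.ofReal (v g) • Measure.dirac g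

theorem ofVec_singleton [DiscreteMeasurableSpace G] (v : G → ℝ) (a : G) : ofVec v {a} = ENNReal.ofReal (v a) := by
  classical
  simp only [ofVec, Measure.finsetSum_apply, Measure.smul_apply, smul_eq_mul,
    Measure.dirac_apply' _ (MeasurableSet.of_discrete (s := {a})), Set.indicator_apply,
    Set.mem_singleton_iff, Pi.one_apply, mul_ite, mul_one, mul_zero]
  simp

theorem ofVec_real [DiscreteMeasurableSpace G] {v : G → ℝ} (hv : v ∈ stdSimplex ℝ G) (a : G) : (ofVec v).real {a} = v a := by
  rw [Measure.real, ofVec_singleton, ENNReal.toReal_ofReal (hv.1 a)]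

theorem ofVec_prob {v : G → ℝ} (hv : v ∈ stdSimplex ℝ G) : IsProbabilityMeasure (ofVec v) := by
  constructor
  simp only [ofVec, Measure.finsetSum_apply, Measure.smul_apply, smul_eq_mul, measure_univ,
    mul_one]
  rw [← ENNReal.ofReal_sum_of_nonneg (fun i _ => hv.1 i), hv.2, ENNReal.ofReal_one]

theorem real_mem_stdSimplex [DiscreteMeasurableSpace G] (p : Measure G) [IsProbabilityMeasure p] :
    (fun g => p.real {g}) ∈ stdSimplex ℝ G := by
  refine ⟨fun g => measureReal_nonneg, ?_⟩
  have h := sum_measureReal_singleton (μ := p) (Finset.univ : Finset G)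
  rw [h, Finset.coe_univ, probReal_univ]

theorem conv_real [AddCommGroup G] [DiscreteMeasurableSpace G] (p q : Measure G)
    [IsProbabilityMeasure p] [IsProbabilityMeasure q] (g : G) :
    (p.conv q).real {g} = ∑ a : G, p.real {a} * q.real {g - a} := by
  classical
  rw [Measure.conv, map_measureReal_apply .of_discrete .of_discrete]
  have hset : (fun x : G × G => x.1 + x.2) ⁻¹' {g}
      = ((Finset.univ.image fun a : G => (a, g - a) : Finset (G × G)) : Set (G × G)) := by
    ext ⟨a, b⟩
    simp only [Set.mem_preimage, Set.mem_singleton_iff, Finset.coe_image, Finset.coe_univ,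
      Set.image_univ, Set.mem_range, Prod.mk.injEq]
    constructor
    · intro h
      exact ⟨a, rfl, by rw [← h]; abel⟩
    · rintro ⟨c, rfl, rfl⟩
      abel
  rw [hset, ← sum_measureReal_singleton, Finset.sum_image (fun a _ b _ h => (Prod.mk.inj h).1)]
  refine Finset.sum_congr rfl fun a _ => ?_
  rw [← Set.singleton_prod_singleton, measureReal_prod_prod]

/-- Every value in `[0, log |G|]` is the entropy of some probability vector. -/
theorem exists_entropy_eq (G : Type*) [Fintype G] [Nonempty G] {x : ℝ} (h0 : 0 ≤ x)
    (h1 : x ≤ Real.log (Fintype.card G)) :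
    ∃ v ∈ stdSimplex ℝ G, ∑ g, Real.negMulLog (v g) = x := by
  classical
  let z : G := Classical.arbitrary G
  have hcard : (0 : ℝ) < Fintype.card G := by exact_mod_cast Fintype.card_pos
  have hcont : ContinuousOn (fun v : G → ℝ => ∑ g, Real.negMulLog (v g)) (stdSimplex ℝ G) := by
    fun_prop
  have hconn := (convex_stdSimplex ℝ G).isPreconnected
  have hu : (fun _ : G => (Fintype.card G : ℝ)⁻¹) ∈ stdSimplex ℝ G :=
    ⟨fun _ => by positivity, by simp [hcard.ne']⟩
  have hs : (Pi.single z (1 : ℝ)) ∈ stdSimplex ℝ G := single_mem_stdSimplex ℝ z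
  have e0 : ∑ g : G, Real.negMulLog ((Pi.single z (1 : ℝ) : G → ℝ) g) = 0 := by
    refine Finset.sum_eq_zero fun g _ => ?_
    by_cases h : g = z
    · subst h; simp
    · simp [h]
  have e1 : ∑ _g : G, Real.negMulLog ((Fintype.card G : ℝ)⁻¹) = Real.log (Fintype.card G) := by
    simp only [Finset.sum_const, Finset.card_univ, nsmul_eq_mul, Real.negMulLog, Real.log_inv]
    field_simp
  have himg := hconn.intermediate_value hs hu hcont
  simp only [e0, e1] at himg
  obtain ⟨v, hv, hvx⟩ := himg ⟨h0, h1⟩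
  exact ⟨v, hv, hvx⟩

/-- The minimum in the definition of `f_G` is attained on `[0, log |G|] × [0, log |G|]`. -/
theorem fG_isLeast [AddCommGroup G] [DiscreteMeasurableSpace G] {x y : ℝ} (hx0 : 0 ≤ x)
    (hx1 : x ≤ Real.log (Fintype.card G))
    (hy0 : 0 ≤ y) (hy1 : y ≤ Real.log (Fintype.card G)) :
    IsLeast (sumEntropies G x y) (fG G x y) := by
  let H : (G → ℝ) → ℝ := fun v => ∑ g, Real.negMulLog (v g)
  let F : (G → ℝ) × (G → ℝ) → ℝ := fun w => ∑ g, Real.negMulLog (∑ a, w.1 a * w.2 (g - a))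
  let K : Set ((G → ℝ) × (G → ℝ)) :=
    (stdSimplex ℝ G ×ˢ stdSimplex ℝ G) ∩ {w | H w.1 = x ∧ H w.2 = y}
  have hK : IsCompact K := by
    refine ((isCompact_stdSimplex ℝ G).prod (isCompact_stdSimplex ℝ G)).inter_right ?_
    have c1 : Continuous fun w : (G → ℝ) × (G → ℝ) => H w.1 := by fun_prop
    have c2 : Continuous fun w : (G → ℝ) × (G → ℝ) => H w.2 := by fun_prop
    exact (isClosed_eq c1 continuous_const).inter (isClosed_eq c2 continuous_const)
  have hF : Continuous F := by fun_prop
  have hset : sumEntropies G x y = F '' K := by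
    ext h
    constructor
    · rintro ⟨p, q, hp, hq, rfl, rfl, rfl⟩
      refine ⟨(fun g => p.real {g}, fun g => q.real {g}),
        ⟨⟨real_mem_stdSimplex p, real_mem_stdSimplex q⟩, rfl, rfl⟩, ?_⟩
      simp only [F, measureEntropy, conv_real]
    · rintro ⟨⟨v, w⟩, ⟨⟨hv, hw⟩, h1, h2⟩, rfl⟩
      have hv' : v ∈ stdSimplex ℝ G := hv
      have hw' : w ∈ stdSimplex ℝ G := hw
      have := ofVec_prob hv'
      have := ofVec_prob hw'
      refine ⟨ofVec v, ofVec w, ‹_›, ‹_›, ?_, ?_, ?_⟩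
      · simp only [measureEntropy, ofVec_real hv']; exact h1
      · simp only [measureEntropy, ofVec_real hw']; exact h2
      · simp only [measureEntropy, conv_real, ofVec_real hv', ofVec_real hw', F]
  have hne : (F '' K).Nonempty := by
    obtain ⟨v, hv, hvx⟩ := exists_entropy_eq G hx0 hx1
    obtain ⟨w, hw, hwy⟩ := exists_entropy_eq G hy0 hy1
    exact ⟨_, (v, w), ⟨⟨hv, hw⟩, hvx, hwy⟩, rfl⟩
  rw [fG, hset]
  exact (hK.image hF).isLeast_sInf hne

end Attained

end ScalarMGL

/-!
Let `L = log 2`, and let `gerber` be the function `f_G` of `G = ℤ/2`. For every `G` of order a power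
of two, `f_G(x, y) = k L + gerber (x - k L) (y - k L)` on the boxes `[k L, (k + 1) L]²`, and
`f_G(x, y) = max x y` off these boxes. This closed form is `boxGerber`. It is convex in each
argument (`boxGerber_support`), so once it is known to be `f_G`, Jensen's inequality applied to the
conditional laws of `X` gives the claim: given `U = u`, the law of `Y` is the convolution of the
conditional law of `X` with the law of `Z` (`condDistrib_add_ae_eq`).

That `boxGerber` is a lower bound for the entropy of a sum (`boxGerber_le_vecEntropy`) is proved by
induction along a subgroup of index two. The coset of the sum has entropy `gerber u v`, where `u`,
`v` are the entropies of the cosets of the summands. Given the cosets of both summands, the sum has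
conditional entropy at least `boxGerber x y`, by induction and convexity, where `x`, `y` are the
conditional entropies of the summands within their cosets. So the inequality
`boxGerber (u + x) (v + y) ≤ gerber u v + boxGerber x y` (`boxGerber_add_add_le`) is needed. It
reduces to the subadditivity of `gerber` on the square `[0, L]²` and to a variant of it at the
corner `(L, L)`. That the bound is attained (`exists_vecEntropy_eq_boxGerber`) is seen from laws
that are uniform on each of the two cosets, and from laws supported on the subgroup.

For the subadditivity, fix the increment `(a, b)`, and consider the difference
`gerber (u + a) (v + b) - gerber u v` on the rectangle of admissible `(u, v)`. It has no critical
point, since the gradient of `gerber` is injective, so its extrema are on the boundary, where the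
inequalities are elementary. To see that the gradient is injective, parametrize entropies by biases:
`gerber` multiplies biases, and its partial derivatives at biases `a`, `b` are `k (a b) / k a` and
`k (a b) / k b`, with `k a = a * artanh a`. In the doubly logarithmic coordinate `a = exp (-exp q)`
the function `log ∘ k` is strictly concave and decreasing. Hence a scaling of `k` by a factor
greater than one acts on `s = -log a` by a strictly superadditive map, which cannot preserve a
relation `s₁ + s₂ = s₃` (`no_proportional_triple`).
-/

namespace ScalarMGL

open Set Filter Topology Real

/-! ### The inverse hyperbolic tangent -/

theorem hasDerivAt_artanh {x : ℝ} (hx : x ∈ Ioo (-1 : ℝ) 1) :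
    HasDerivAt artanh (1 - x ^ 2)⁻¹ x := by
  have h1 : 0 < 1 + x := by linarith [hx.1]
  have h2 : 0 < 1 - x := by linarith [hx.2]
  have e : artanh =ᶠ[𝓝 x] fun x => 1 / 2 * (log (1 + x) - log (1 - x)) := by
    filter_upwards [Ioo_mem_nhds hx.1 hx.2] with t ht
    rw [artanh_eq_half_log ⟨ht.1.le, ht.2.le⟩,
      log_div (by linarith [ht.1]) (by linarith [ht.2])]
  refine HasDerivAt.congr_of_eventuallyEq ?_ e
  have d1 : HasDerivAt (fun x : ℝ => log (1 + x)) (1 / (1 + x)) x :=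
    ((hasDerivAt_id x).const_add 1).log h1.ne'
  have d2 : HasDerivAt (fun x : ℝ => log (1 - x)) (-1 / (1 - x)) x :=
    ((hasDerivAt_id x).const_sub 1).log h2.ne'
  convert! (d1.sub d2).const_mul (1 / 2) using 1
  have h3 : 1 - x ^ 2 ≠ 0 := by
    have : 1 - x ^ 2 = (1 + x) * (1 - x) := by ring
    rw [this]; positivity
  field_simp
  ring

theorem self_le_artanh {x : ℝ} (h0 : 0 ≤ x) (h1 : x < 1) : x ≤ artanh x := by
  have hanti : MonotoneOn (fun t => artanh t - t) (Ico 0 1) := by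
    have hd : ∀ t ∈ Ico (0 : ℝ) 1, HasDerivAt (fun t => artanh t - t) ((1 - t ^ 2)⁻¹ - 1) t :=
      fun t ht => (hasDerivAt_artanh ⟨by linarith [ht.1], ht.2⟩).sub (hasDerivAt_id t)
    refine monotoneOn_of_deriv_nonneg (convex_Ico 0 1)
      (fun t ht => (hd t ht).continuousAt.continuousWithinAt)
      (fun t ht => (hd t (interior_subset ht)).differentiableAt.differentiableWithinAt)
      fun t ht => ?_
    have ht := interior_subset ht
    rw [(hd t ht).deriv, sub_nonneg]
    exact (one_le_inv₀ (by nlinarith [ht.1, ht.2])).2 (by nlinarith [ht.1])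
  have := hanti ⟨le_rfl, one_pos⟩ ⟨h0, h1⟩ h0
  simp only [artanh_zero, sub_zero] at this
  linarith

theorem artanh_le_div {x : ℝ} (h0 : 0 ≤ x) (h1 : x < 1) : artanh x ≤ x / (1 - x) := by
  have h2 : 0 < 1 - x := by linarith
  rw [artanh_eq_half_log ⟨by linarith, h1.le⟩]
  have := log_le_sub_one_of_pos (x := (1 + x) / (1 - x)) (by positivity)
  calc 1 / 2 * log ((1 + x) / (1 - x)) ≤ 1 / 2 * ((1 + x) / (1 - x) - 1) := by gcongr
    _ = x / (1 - x) := by field_simp; ring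

theorem neg_log_lt {x : ℝ} (h0 : 0 < x) (h1 : x < 1) : -log x < (1 - x ^ 2) / (2 * x) := by
  have hd : ∀ t ∈ Ioc (0 : ℝ) 1, HasDerivAt (fun t => (t⁻¹ - t) / 2 + log t)
      ((-(t ^ 2)⁻¹ - 1) / 2 + t⁻¹) t := fun t ht =>
    (((hasDerivAt_inv ht.1.ne').sub (hasDerivAt_id t)).div_const 2).add
      (hasDerivAt_log ht.1.ne')
  have hanti : StrictAntiOn (fun t => (t⁻¹ - t) / 2 + log t) (Ioc 0 1) := by
    refine strictAntiOn_of_deriv_neg (convex_Ioc 0 1)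
      (fun t ht => (hd t ht).continuousAt.continuousWithinAt) fun t ht => ?_
    rw [interior_Ioc] at ht
    have ht0 := ht.1
    rw [(hd t ⟨ht.1, ht.2.le⟩).deriv]
    have : (-(t ^ 2)⁻¹ - 1) / 2 + t⁻¹ = -((1 - t) ^ 2 / (2 * t ^ 2)) := by
      field_simp; ring
    rw [this, neg_lt_zero]
    have : 0 < 1 - t := by linarith [ht.2]
    positivity
  have := hanti ⟨h0, h1.le⟩ ⟨one_pos, le_rfl⟩ h1
  simp only [inv_one, sub_self, zero_div, log_one, add_zero] at this
  have e : (1 - x ^ 2) / (2 * x) = (x⁻¹ - x) / 2 := by field_simp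
  rw [e]; linarith

/-- The logarithmic derivative `x * artanh' x / artanh x` of `artanh`. -/
noncomputable def artanhElasticity (x : ℝ) : ℝ := x / ((1 - x ^ 2) * artanh x)

theorem hasDerivAt_artanhElasticity {x : ℝ} (hx : x ∈ Ioo (0 : ℝ) 1) :
    HasDerivAt artanhElasticity
      (((1 + x ^ 2) * artanh x - x) / ((1 - x ^ 2) * artanh x) ^ 2) x := by
  have hA := artanh_pos hx
  have h2 : 0 < 1 - x ^ 2 := by nlinarith [hx.1, hx.2]
  have d := (hasDerivAt_id x).div
    ((((hasDerivAt_id x).pow 2).const_sub 1).mul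
      (hasDerivAt_artanh ⟨by linarith [hx.1], hx.2⟩)) (by simp; exact ⟨h2.ne', hA.ne'⟩)
  convert! d using 1
  simp
  field_simp
  ring

theorem artanhElasticity_monotoneOn : MonotoneOn artanhElasticity (Ioo 0 1) := by
  refine monotoneOn_of_deriv_nonneg (convex_Ioo 0 1)
    (fun t ht => (hasDerivAt_artanhElasticity ht).continuousAt.continuousWithinAt)
    (fun t ht => (hasDerivAt_artanhElasticity
      (interior_subset ht)).differentiableAt.differentiableWithinAt) fun t ht => ?_
  have ht := interior_subset ht
  rw [(hasDerivAt_artanhElasticity ht).deriv]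
  have := self_le_artanh ht.1.le ht.2
  refine div_nonneg ?_ (sq_nonneg _)
  nlinarith [sq_nonneg t, ht.1]

/-- The derivative of the ratio has the sign of `artanhElasticity (a * b) - artanhElasticity a`. -/
theorem artanh_mul_div_antitoneOn {b : ℝ} (hb : b ∈ Icc (0 : ℝ) 1) :
    AntitoneOn (fun a => artanh (a * b) / artanh a) (Ioo 0 1) := by
  rcases hb.1.eq_or_lt with rfl | hb0
  · intro x _ y _ _; simp
  have hab : ∀ a ∈ Ioo (0 : ℝ) 1, a * b ∈ Ioo (0 : ℝ) 1 := fun a ha =>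
    ⟨mul_pos ha.1 hb0, by nlinarith [ha.1, ha.2, hb.2]⟩
  have hd : ∀ a ∈ Ioo (0 : ℝ) 1, HasDerivAt (fun a => artanh (a * b) / artanh a)
      (artanh (a * b) / (a * artanh a) *
        (artanhElasticity (a * b) - artanhElasticity a)) a := fun a ha => by
    have hA := artanh_pos ha
    have hB := artanh_pos (hab a ha)
    have h1 : 0 < 1 - a ^ 2 := by nlinarith [ha.1, ha.2]
    have h2 : 0 < 1 - (a * b) ^ 2 := by nlinarith [(hab a ha).1, (hab a ha).2]
    have d1 : HasDerivAt (fun a => artanh (a * b)) ((1 - (a * b) ^ 2)⁻¹ * b) a :=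
      HasDerivAt.comp (h₂ := artanh) a
        (hasDerivAt_artanh ⟨by linarith [(hab a ha).1], (hab a ha).2⟩) (hasDerivAt_mul_const b)
    convert! d1.div (hasDerivAt_artanh ⟨by linarith [ha.1], ha.2⟩) hA.ne' using 1
    have := ha.1
    unfold artanhElasticity
    field_simp
  refine antitoneOn_of_deriv_nonpos (convex_Ioo 0 1)
    (fun t ht => (hd t ht).continuousAt.continuousWithinAt)
    (fun t ht => (hd t (interior_subset ht)).differentiableAt.differentiableWithinAt)
    fun t ht => ?_
  have ht := interior_subset ht
  rw [(hd t ht).deriv]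
  have hA := artanh_pos ht
  have hB := artanh_pos (hab t ht)
  have h0 := ht.1
  refine mul_nonpos_of_nonneg_of_nonpos (by positivity) (sub_nonpos.2 ?_)
  exact artanhElasticity_monotoneOn (hab t ht) ht (by nlinarith [hb.2])

/-! ### Rigidity of proportional triples -/

/-- With `a = exp (-exp q)`, this is the rate at which `log (a * artanh a)` decreases in `q`. -/
noncomputable def logRate (a : ℝ) : ℝ := -log a * (1 + artanhElasticity a)

/-- The factor `-log a` is bounded by `neg_log_lt`, which turns the sign of the derivative into a
polynomial inequality between `a` and `artanh a`. -/
theorem logRate_strictAntiOn : StrictAntiOn logRate (Ioo 0 1) := by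
  have hd : ∀ a ∈ Ioo (0 : ℝ) 1, HasDerivAt logRate
      (-a⁻¹ * (1 + artanhElasticity a) + -log a *
        (((1 + a ^ 2) * artanh a - a) / ((1 - a ^ 2) * artanh a) ^ 2)) a := fun a ha =>
    (hasDerivAt_log ha.1.ne').neg.mul ((hasDerivAt_artanhElasticity ha).const_add 1)
  refine strictAntiOn_of_deriv_neg (convex_Ioo 0 1)
    (fun t ht => (hd t ht).continuousAt.continuousWithinAt) fun t ht => ?_
  have ht : t ∈ Ioo (0 : ℝ) 1 := interior_subset ht
  rw [(hd t ht).deriv]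
  have hA := artanh_pos ht
  obtain ⟨h0, h1⟩ := ht
  have h2 : 0 < 1 - t ^ 2 := by nlinarith
  have h3 : 0 < 1 - t := by linarith
  have hA1 := self_le_artanh h0.le h1
  have hA2 := artanh_le_div h0.le h1
  rw [le_div_iff₀ h3] at hA2
  have hl := neg_log_lt h0 h1
  set A := artanh t
  have hnum : 0 < (1 + t ^ 2) * A - t := by nlinarith [mul_pos (pow_pos h0 2) hA]
  have key : (1 + t ^ 2) * A - t ≤ 2 * A * ((1 - t ^ 2) * A + t) := by
    nlinarith [mul_pos (mul_pos hA hA) h2, mul_nonneg h3.le (sub_nonneg.2 hA2)]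
  have s1 : -log t * (((1 + t ^ 2) * A - t) / ((1 - t ^ 2) * A) ^ 2) <
      (1 - t ^ 2) / (2 * t) * (((1 + t ^ 2) * A - t) / ((1 - t ^ 2) * A) ^ 2) := by
    gcongr
  have s2 : (1 - t ^ 2) / (2 * t) * (((1 + t ^ 2) * A - t) / ((1 - t ^ 2) * A) ^ 2) ≤
      t⁻¹ * (1 + artanhElasticity t) := by
    have e1 : (1 - t ^ 2) / (2 * t) * (((1 + t ^ 2) * A - t) / ((1 - t ^ 2) * A) ^ 2) =
        ((1 + t ^ 2) * A - t) / (2 * t * (1 - t ^ 2) * A ^ 2) := by field_simp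
    have e2 : t⁻¹ * (1 + artanhElasticity t) =
        (2 * A * ((1 - t ^ 2) * A + t)) / (2 * t * (1 - t ^ 2) * A ^ 2) := by
      change t⁻¹ * (1 + t / ((1 - t ^ 2) * A)) = _
      field_simp
    rw [e1, e2]
    gcongr
  linarith

/-- The function `a * artanh a`. -/
noncomputable def mulArtanh (a : ℝ) : ℝ := a * artanh a

theorem mulArtanh_pos {a : ℝ} (ha : a ∈ Ioo (0 : ℝ) 1) : 0 < mulArtanh a :=
  mul_pos ha.1 (artanh_pos ha)

theorem mulArtanh_strictMonoOn : StrictMonoOn mulArtanh (Ioo 0 1) := fun a ha b hb hab =>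
  mul_lt_mul hab (artanh_le_artanh (by linarith [ha.1]) hb.2 hab.le) (artanh_pos ha) hb.1.le

/-- `log (a * artanh a)` in the doubly logarithmic coordinate `a = exp (-exp q)`. -/
noncomputable def logMulArtanh (q : ℝ) : ℝ := log (mulArtanh (exp (-exp q)))

theorem exp_neg_exp_mem (q : ℝ) : exp (-exp q) ∈ Ioo (0 : ℝ) 1 :=
  ⟨exp_pos _, exp_lt_one_iff.2 (neg_lt_zero.2 (exp_pos q))⟩

theorem hasDerivAt_logMulArtanh (q : ℝ) :
    HasDerivAt logMulArtanh (-logRate (exp (-exp q))) q := by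
  have hm := exp_neg_exp_mem q
  have hA := artanh_pos hm
  have d1 : HasDerivAt (fun q => exp (-exp q)) (exp (-exp q) * -exp q) q :=
    (hasDerivAt_exp q).neg.exp
  have d2 : HasDerivAt mulArtanh (1 * artanh (exp (-exp q)) +
      exp (-exp q) * (1 - exp (-exp q) ^ 2)⁻¹) (exp (-exp q)) :=
    (hasDerivAt_id (exp (-exp q))).mul (hasDerivAt_artanh ⟨by linarith [hm.1], hm.2⟩)
  have d3 := (HasDerivAt.comp (h₂ := mulArtanh) q d2 d1).log (mulArtanh_pos hm).ne'
  convert! d3 using 1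
  simp only [logRate, artanhElasticity, log_exp, Function.comp, mulArtanh]
  have h2 : 0 < 1 - exp (-exp q) ^ 2 := by nlinarith [hm.1, hm.2]
  have := hm.1
  generalize exp (-exp q) = a at *
  field_simp

theorem logMulArtanh_strictAnti : StrictAnti logMulArtanh := fun p q hpq => by
  refine log_lt_log (mulArtanh_pos (exp_neg_exp_mem q)) ?_
  exact mulArtanh_strictMonoOn (exp_neg_exp_mem q) (exp_neg_exp_mem p)
    (exp_lt_exp.2 (neg_lt_neg (exp_lt_exp.2 hpq)))

/-- Strict concavity of `logMulArtanh`, in the form of strictly monotone increments. -/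
theorem logMulArtanh_sub_strictMono {d : ℝ} (hd : 0 < d) :
    StrictMono fun q => logMulArtanh (q - d) - logMulArtanh q := by
  refine strictMono_of_deriv_pos fun q => ?_
  have h := ((hasDerivAt_logMulArtanh (q - d)).comp_sub_const q d).sub (hasDerivAt_logMulArtanh q)
  have h' : HasDerivAt (fun q => logMulArtanh (q - d) - logMulArtanh q) _ q := h
  rw [h'.deriv]
  have := logRate_strictAntiOn (exp_neg_exp_mem q) (exp_neg_exp_mem (q - d))
    (exp_lt_exp.2 (neg_lt_neg (exp_lt_exp.2 (by linarith))))
  linarith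

/-- By concavity, the same increase `c` of the decreasing function `logMulArtanh` takes a smaller
step to the left when it starts further to the right. -/
theorem sub_lt_sub_of_logMulArtanh {p p' q q' c : ℝ} (hc : 0 < c) (hpq : p < q)
    (hp : logMulArtanh p' = logMulArtanh p + c) (hq : logMulArtanh q' = logMulArtanh q + c) :
    q - q' < p - p' := by
  by_contra! h
  have hp' : p' < p := logMulArtanh_strictAnti.lt_iff_gt.1 (by linarith)
  have h1 := logMulArtanh_sub_strictMono (sub_pos.2 hp') hpq
  have h2 : logMulArtanh (q - (p - p')) ≤ logMulArtanh q' :=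
    logMulArtanh_strictAnti.antitone (by linarith)
  simp only [sub_sub_cancel] at h1
  linarith

/-- In the coordinate `a = exp (-s)`, a scaling of `mulArtanh` acts on the `s` by a strictly
superadditive map. Hence it preserves the additive relation `s₁ + s₂ = s₃` only if it is
trivial. -/
theorem no_proportional_triple {q₁ q₂ q₃ r₁ r₂ r₃ c : ℝ} (hc : 0 < c)
    (hq : exp q₁ + exp q₂ = exp q₃) (hr : exp r₁ + exp r₂ = exp r₃)
    (h₁ : logMulArtanh r₁ = logMulArtanh q₁ + c) (h₂ : logMulArtanh r₂ = logMulArtanh q₂ + c)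
    (h₃ : logMulArtanh r₃ = logMulArtanh q₃ + c) : False := by
  have l1 : q₁ < q₃ := exp_lt_exp.1 (by linarith [exp_pos q₂])
  have l2 : q₂ < q₃ := exp_lt_exp.1 (by linarith [exp_pos q₁])
  have m1 := sub_lt_sub_of_logMulArtanh hc l1 h₁ h₃
  have m2 := sub_lt_sub_of_logMulArtanh hc l2 h₂ h₃
  have e1 : exp r₁ < exp q₁ * exp (r₃ - q₃) := by rw [← exp_add]; exact exp_lt_exp.2 (by linarith)
  have e2 : exp r₂ < exp q₂ * exp (r₃ - q₃) := by rw [← exp_add]; exact exp_lt_exp.2 (by linarith)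
  have e3 : exp r₃ = exp q₃ * exp (r₃ - q₃) := by rw [← exp_add]; congr 1; ring
  rw [← hq] at e3
  nlinarith

theorem exists_exp_neg_exp {a : ℝ} (ha : a ∈ Ioo (0 : ℝ) 1) : ∃ q, exp (-exp q) = a :=
  ⟨log (-log a), by
    rw [exp_log (neg_pos.2 (log_neg ha.1 ha.2)), neg_neg, exp_log ha.1]⟩

/-- The pair `(a, b)` is determined by the two ratios. As the hypotheses are symmetric, `a = a'` is
enough. -/
theorem eq_of_mulArtanh_ratio_eq {a b a' b' : ℝ} (ha : a ∈ Ioo (0 : ℝ) 1)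
    (hb : b ∈ Ioo (0 : ℝ) 1) (ha' : a' ∈ Ioo (0 : ℝ) 1) (hb' : b' ∈ Ioo (0 : ℝ) 1)
    (h₁ : mulArtanh (a * b) / mulArtanh a = mulArtanh (a' * b') / mulArtanh a')
    (h₂ : mulArtanh (a * b) / mulArtanh b = mulArtanh (a' * b') / mulArtanh b') : a = a' := by
  have hab : a * b ∈ Ioo (0 : ℝ) 1 := ⟨mul_pos ha.1 hb.1, by nlinarith [ha.1, ha.2, hb.2]⟩
  have hab' : a' * b' ∈ Ioo (0 : ℝ) 1 :=
    ⟨mul_pos ha'.1 hb'.1, by nlinarith [ha'.1, ha'.2, hb'.2]⟩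
  have l₁ := congrArg log h₁
  have l₂ := congrArg log h₂
  rw [log_div (mulArtanh_pos hab).ne' (mulArtanh_pos ha).ne',
    log_div (mulArtanh_pos hab').ne' (mulArtanh_pos ha').ne'] at l₁
  rw [log_div (mulArtanh_pos hab).ne' (mulArtanh_pos hb).ne',
    log_div (mulArtanh_pos hab').ne' (mulArtanh_pos hb').ne'] at l₂
  obtain ⟨q₁, e₁⟩ := exists_exp_neg_exp ha
  obtain ⟨q₂, e₂⟩ := exists_exp_neg_exp hb
  obtain ⟨q₃, e₃⟩ := exists_exp_neg_exp hab
  obtain ⟨r₁, d₁⟩ := exists_exp_neg_exp ha'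
  obtain ⟨r₂, d₂⟩ := exists_exp_neg_exp hb'
  obtain ⟨r₃, d₃⟩ := exists_exp_neg_exp hab'
  have hq : exp q₁ + exp q₂ = exp q₃ := by
    have : exp (-exp q₃) = exp (-exp q₁ + -exp q₂) := by rw [exp_add, e₁, e₂, e₃]
    have := exp_injective this
    linarith
  have hr : exp r₁ + exp r₂ = exp r₃ := by
    have : exp (-exp r₃) = exp (-exp r₁ + -exp r₂) := by rw [exp_add, d₁, d₂, d₃]
    have := exp_injective this
    linarith
  rw [← e₃, ← e₁, ← d₃, ← d₁] at l₁
  rw [← e₃, ← e₂, ← d₃, ← d₂] at l₂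
  change logMulArtanh q₃ - logMulArtanh q₁ = logMulArtanh r₃ - logMulArtanh r₁ at l₁
  change logMulArtanh q₃ - logMulArtanh q₂ = logMulArtanh r₃ - logMulArtanh r₂ at l₂
  -- The three values of `logMulArtanh` differ by a common constant, which has to vanish.
  rcases lt_trichotomy (logMulArtanh q₁) (logMulArtanh r₁) with h | h | h
  · exact (no_proportional_triple (c := logMulArtanh r₁ - logMulArtanh q₁) (by linarith) hq hr
      (by ring) (by linarith) (by linarith)).elim
  · rw [← e₁, ← d₁, logMulArtanh_strictAnti.injective h]
  · exact (no_proportional_triple (c := logMulArtanh q₁ - logMulArtanh r₁) (by linarith) hr hq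
      (by ring) (by linarith) (by linarith)).elim

/-! ### The binary function of Mrs. Gerber -/

theorem log_two_pos : 0 < log 2 := log_pos one_lt_two

/-- The entropy of a bit whose two probabilities differ by `a`. -/
noncomputable def biasEntropy (a : ℝ) : ℝ := binEntropy ((1 - a) / 2)

theorem continuous_biasEntropy : Continuous biasEntropy := by unfold biasEntropy; fun_prop

theorem biasEntropy_strictAntiOn : StrictAntiOn biasEntropy (Icc 0 1) := fun a ha b hb hab =>
  binEntropy_strictMonoOn ⟨by linarith [hb.2], by linarith [hb.1]⟩
    ⟨by linarith [ha.2], by linarith [ha.1]⟩ (by linarith)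

theorem biasEntropy_zero : biasEntropy 0 = log 2 := by simp [biasEntropy]

theorem biasEntropy_one : biasEntropy 1 = 0 := by simp [biasEntropy]

theorem biasEntropy_mem {a : ℝ} (ha : a ∈ Icc (0 : ℝ) 1) : biasEntropy a ∈ Icc 0 (log 2) :=
  ⟨binEntropy_nonneg (by linarith [ha.2]) (by linarith [ha.1]), binEntropy_le_log_two⟩

theorem hasDerivAt_biasEntropy {a : ℝ} (ha : a ∈ Ioo (-1 : ℝ) 1) :
    HasDerivAt biasEntropy (-artanh a) a := by
  have h1 : 0 < 1 + a := by linarith [ha.1]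
  have h2 : 0 < 1 - a := by linarith [ha.2]
  have d := HasDerivAt.comp (h₂ := binEntropy) a
    (hasDerivAt_binEntropy (p := (1 - a) / 2) (by positivity) (by linarith))
    (((hasDerivAt_id a).const_sub 1).div_const 2)
  convert! d using 1
  rw [artanh_eq_half_log ⟨ha.1.le, ha.2.le⟩, log_div h1.ne' h2.ne',
    show 1 - (1 - a) / 2 = (1 + a) / 2 by ring, log_div h1.ne' two_ne_zero,
    log_div h2.ne' two_ne_zero]
  ring

/-- Binary entropy as an order isomorphism `[0, 1/2] ≃ [0, log 2]`. -/
noncomputable def binEntropyIso : Icc (0 : ℝ) 2⁻¹ ≃o Icc (0 : ℝ) (log 2) :=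
  StrictMono.orderIsoOfSurjective
    (fun p => ⟨binEntropy p, binEntropy_nonneg p.2.1 (by linarith [p.2.2]),
      binEntropy_le_log_two⟩)
    (fun p q h => binEntropy_strictMonoOn p.2 q.2 h) fun ⟨x, hx⟩ => by
      have := intermediate_value_Icc (by norm_num)
        (binEntropy_continuous.continuousOn (s := Icc 0 2⁻¹))
      rw [binEntropy_zero, binEntropy_two_inv] at this
      obtain ⟨p, hp, e⟩ := this hx
      exact ⟨⟨p, hp⟩, Subtype.ext e⟩

/-- The bias in `[0, 1]` of a bit of entropy `x`, constant outside of `[0, log 2]`. -/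
noncomputable def bias (x : ℝ) : ℝ :=
  1 - 2 * (binEntropyIso.symm (projIcc 0 (log 2) log_two_pos.le x) : ℝ)

theorem continuous_bias : Continuous bias := by
  have h1 : Continuous binEntropyIso.symm := binEntropyIso.symm.continuous
  have h2 : Continuous (projIcc 0 (log 2) log_two_pos.le) := continuous_projIcc
  unfold bias
  exact continuous_const.sub (continuous_const.mul
    (continuous_subtype_val.comp (h1.comp h2)))

theorem bias_mem (x : ℝ) : bias x ∈ Icc (0 : ℝ) 1 := by
  have := (binEntropyIso.symm (projIcc 0 (log 2) log_two_pos.le x)).2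
  unfold bias
  constructor <;> linarith [this.1, this.2]

theorem bias_antitone : Antitone bias := fun x y h => by
  have : (binEntropyIso.symm (projIcc 0 (log 2) log_two_pos.le x) : ℝ) ≤
      binEntropyIso.symm (projIcc 0 (log 2) log_two_pos.le y) :=
    binEntropyIso.symm.monotone (monotone_projIcc _ h)
  unfold bias
  linarith

theorem biasEntropy_bias {x : ℝ} (hx : x ∈ Icc 0 (log 2)) : biasEntropy (bias x) = x := by
  have h := binEntropyIso.apply_symm_apply (projIcc 0 (log 2) log_two_pos.le x)
  have h' := congrArg Subtype.val h
  rw [projIcc_of_mem _ hx] at h'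
  simp only [biasEntropy, bias, sub_sub_cancel]
  rw [projIcc_of_mem _ hx, mul_div_cancel_left₀ _ two_ne_zero]
  exact h'

theorem bias_biasEntropy {a : ℝ} (ha : a ∈ Icc (0 : ℝ) 1) : bias (biasEntropy a) = a :=
  biasEntropy_strictAntiOn.injOn (bias_mem _) ha (biasEntropy_bias (biasEntropy_mem ha))

theorem bias_zero : bias 0 = 1 := by
  rw [← biasEntropy_one, bias_biasEntropy ⟨zero_le_one, le_rfl⟩]

theorem bias_log_two : bias (log 2) = 0 := by
  rw [← biasEntropy_zero, bias_biasEntropy ⟨le_rfl, zero_le_one⟩]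

theorem bias_injOn : InjOn bias (Icc 0 (log 2)) := fun x hx y hy h => by
  rw [← biasEntropy_bias hx, h, biasEntropy_bias hy]

theorem bias_mem_Ioo {x : ℝ} (hx : x ∈ Ioo 0 (log 2)) : bias x ∈ Ioo (0 : ℝ) 1 := by
  have hx' := Ioo_subset_Icc_self hx
  refine ⟨(bias_mem x).1.lt_of_ne fun h => ?_, (bias_mem x).2.lt_of_ne fun h => ?_⟩
  · exact hx.2.ne (bias_injOn hx' ⟨log_two_pos.le, le_rfl⟩ (by rw [← h, bias_log_two]))
  · exact hx.1.ne' (bias_injOn hx' ⟨le_rfl, log_two_pos.le⟩ (by rw [h, bias_zero]))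

theorem hasDerivAt_bias {x : ℝ} (hx : x ∈ Ioo 0 (log 2)) :
    HasDerivAt bias (-artanh (bias x))⁻¹ x := by
  have hb := bias_mem_Ioo hx
  refine HasDerivAt.of_local_left_inverse continuous_bias.continuousAt
    (hasDerivAt_biasEntropy ⟨by linarith [hb.1], hb.2⟩) (neg_ne_zero.2 (artanh_pos hb).ne') ?_
  filter_upwards [Ioo_mem_nhds hx.1 hx.2] with t ht
  exact biasEntropy_bias (Ioo_subset_Icc_self ht)

/-- The entropy of the sum modulo 2 of independent bits of entropies `x` and `y`, at most
`log 2` each: biases multiply. -/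
noncomputable def gerber (x y : ℝ) : ℝ := biasEntropy (bias x * bias y)

theorem gerber_comm (x y : ℝ) : gerber x y = gerber y x := by simp only [gerber, mul_comm]

theorem continuous_gerber : Continuous fun p : ℝ × ℝ => gerber p.1 p.2 :=
  continuous_biasEntropy.comp
    ((continuous_bias.comp continuous_fst).mul (continuous_bias.comp continuous_snd))

theorem bias_mul_mem (x y : ℝ) : bias x * bias y ∈ Icc (0 : ℝ) 1 :=
  ⟨mul_nonneg (bias_mem x).1 (bias_mem y).1,
    mul_le_one₀ (bias_mem x).2 (bias_mem y).1 (bias_mem y).2⟩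

theorem gerber_mono {x x' : ℝ} (h : x ≤ x') (y : ℝ) : gerber x y ≤ gerber x' y :=
  biasEntropy_strictAntiOn.antitoneOn (bias_mul_mem _ _) (bias_mul_mem _ _)
    (mul_le_mul_of_nonneg_right (bias_antitone h) (bias_mem y).1)

theorem left_le_gerber {x : ℝ} (hx : x ∈ Icc 0 (log 2)) (y : ℝ) : x ≤ gerber x y := by
  conv_lhs => rw [← biasEntropy_bias hx]
  exact biasEntropy_strictAntiOn.antitoneOn (bias_mul_mem _ _) (bias_mem _)
    (mul_le_of_le_one_right (bias_mem x).1 (bias_mem y).2)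

theorem right_le_gerber {y : ℝ} (hy : y ∈ Icc 0 (log 2)) (x : ℝ) : y ≤ gerber x y := by
  rw [gerber_comm]; exact left_le_gerber hy x

theorem gerber_zero_left {y : ℝ} (hy : y ∈ Icc 0 (log 2)) : gerber 0 y = y := by
  rw [gerber, bias_zero, one_mul, biasEntropy_bias hy]

theorem gerber_log_two_left (y : ℝ) : gerber (log 2) y = log 2 := by
  rw [gerber, bias_log_two, zero_mul, biasEntropy_zero]

theorem gerber_biasEntropy {a b : ℝ} (ha : a ∈ Icc (0 : ℝ) 1) (hb : b ∈ Icc (0 : ℝ) 1) :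
    gerber (biasEntropy a) (biasEntropy b) = biasEntropy (a * b) := by
  rw [gerber, bias_biasEntropy ha, bias_biasEntropy hb]

theorem hasDerivAt_gerber {x : ℝ} (hx : x ∈ Ioo 0 (log 2)) (y : ℝ) :
    HasDerivAt (fun x => gerber x y) (bias y * (artanh (bias x * bias y) / artanh (bias x))) x := by
  have hb := bias_mem_Ioo hx
  have hm : bias x * bias y ∈ Ioo (-1 : ℝ) 1 :=
    ⟨by linarith [(bias_mul_mem x y).1], by nlinarith [hb.1, hb.2, (bias_mem y).2]⟩
  have d := HasDerivAt.comp (h₂ := biasEntropy) x (hasDerivAt_biasEntropy hm)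
    ((hasDerivAt_bias hx).mul_const (bias y))
  convert! d using 1
  have := (artanh_pos hb).ne'
  field_simp

theorem continuous_gerber_left (y : ℝ) : Continuous fun x => gerber x y :=
  continuous_biasEntropy.comp (continuous_bias.mul continuous_const)

/-- Convexity of the binary function in one argument. -/
theorem gerber_convexOn (y : ℝ) : ConvexOn ℝ (Icc 0 (log 2)) fun x => gerber x y := by
  refine MonotoneOn.convexOn_of_deriv (convex_Icc _ _) (continuous_gerber_left y).continuousOn
    (fun x hx => ?_) fun x hx x' hx' h => ?_
  · rw [interior_Icc] at hx
    exact (hasDerivAt_gerber hx y).differentiableAt.differentiableWithinAt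
  · rw [interior_Icc] at hx hx'
    rw [(hasDerivAt_gerber hx y).deriv, (hasDerivAt_gerber hx' y).deriv]
    exact mul_le_mul_of_nonneg_left (artanh_mul_div_antitoneOn (bias_mem y) (bias_mem_Ioo hx')
      (bias_mem_Ioo hx) (bias_antitone h)) (bias_mem y).1

theorem gerber_deriv_mem {x : ℝ} (hx : x ∈ Ioo 0 (log 2)) (y : ℝ) :
    bias y * (artanh (bias x * bias y) / artanh (bias x)) ∈ Icc (0 : ℝ) 1 := by
  have hb := bias_mem_Ioo hx
  have hA := artanh_pos hb
  refine ⟨mul_nonneg (bias_mem y).1 (div_nonneg (artanh_nonneg (bias_mul_mem x y).1) hA.le),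
    mul_le_one₀ (bias_mem y).2 (div_nonneg (artanh_nonneg (bias_mul_mem x y).1) hA.le) ?_⟩
  rw [div_le_one hA]
  exact artanh_le_artanh (by linarith [(bias_mul_mem x y).1]) hb.2
    (mul_le_of_le_one_right hb.1.le (bias_mem y).2)

/-- Tangent lines support the binary function from below. -/
theorem gerber_support {x₀ : ℝ} (hx₀ : x₀ ∈ Ioo 0 (log 2)) (y : ℝ) :
    ∃ m ∈ Icc (0 : ℝ) 1, ∀ x ∈ Icc 0 (log 2), gerber x₀ y + m * (x - x₀) ≤ gerber x y := by
  refine ⟨_, gerber_deriv_mem hx₀ y, fun x hx => ?_⟩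
  have hc := gerber_convexOn y
  have hd := hasDerivAt_gerber hx₀ y
  rcases lt_trichotomy x x₀ with h | rfl | h
  · have := hc.slope_le_of_hasDerivAt hx (Ioo_subset_Icc_self hx₀) h hd
    rw [slope_def_field, div_le_iff₀ (sub_pos.2 h)] at this
    linarith
  · simp
  · have := hc.le_slope_of_hasDerivAt (Ioo_subset_Icc_self hx₀) hx h hd
    rw [slope_def_field, le_div_iff₀ (sub_pos.2 h)] at this
    linarith

/-- The binary function is 1-Lipschitz in one argument. -/
theorem gerber_add_le {x d : ℝ} (hx : 0 ≤ x) (hd : 0 ≤ d) (hxd : x + d ≤ log 2) (y : ℝ) :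
    gerber (x + d) y ≤ gerber x y + d := by
  have hanti : AntitoneOn (fun x => gerber x y - x) (Icc 0 (log 2)) := by
    have hder : ∀ t ∈ Ioo 0 (log 2), HasDerivAt (fun x => gerber x y - x)
        (bias y * (artanh (bias t * bias y) / artanh (bias t)) - 1) t := fun t ht =>
      (hasDerivAt_gerber ht y).sub (hasDerivAt_id t)
    refine antitoneOn_of_deriv_nonpos (convex_Icc _ _)
      ((continuous_gerber_left y).sub continuous_id).continuousOn (fun t ht => ?_) fun t ht => ?_
    · rw [interior_Icc] at ht
      exact (hder t ht).differentiableAt.differentiableWithinAt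
    · rw [interior_Icc] at ht
      rw [(hder t ht).deriv]
      linarith [(gerber_deriv_mem ht y).2]
  have := hanti ⟨hx, by linarith⟩ ⟨by linarith, hxd⟩ (by linarith : x ≤ x + d)
  simp only at this
  linarith

/-! ### Subadditivity of the binary function -/

/-- The gradient `(d, e)` of the binary function is injective in the interior of the square;
equality of the other coordinates follows by symmetry. -/
theorem eq_of_gerber_deriv_eq {x y x' y' d e : ℝ} (hx : x ∈ Ioo 0 (log 2))
    (hy : y ∈ Ioo 0 (log 2)) (hx' : x' ∈ Ioo 0 (log 2)) (hy' : y' ∈ Ioo 0 (log 2))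
    (h₁ : HasDerivAt (fun t => gerber t y) d x) (h₂ : HasDerivAt (fun t => gerber t x) e y)
    (h₁' : HasDerivAt (fun t => gerber t y') d x') (h₂' : HasDerivAt (fun t => gerber t x') e y') :
    x = x' := by
  have e₁ := (h₁.unique (hasDerivAt_gerber hx y)).symm.trans
    (h₁'.unique (hasDerivAt_gerber hx' y'))
  have e₂ := (h₂.unique (hasDerivAt_gerber hy x)).symm.trans
    (h₂'.unique (hasDerivAt_gerber hy' x'))
  have hb := bias_mem_Ioo hx
  have hb' := bias_mem_Ioo hx'
  have hc := bias_mem_Ioo hy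
  have hc' := bias_mem_Ioo hy'
  have key : ∀ a b : ℝ, a ∈ Ioo (0 : ℝ) 1 →
      b * (artanh (a * b) / artanh a) = mulArtanh (a * b) / mulArtanh a := fun a b ha => by
    have := ha.1
    have := (artanh_pos ha).ne'
    unfold mulArtanh
    field_simp
  rw [key _ _ hb, key _ _ hb'] at e₁
  rw [key _ _ hc, key _ _ hc', mul_comm (bias y), mul_comm (bias y')] at e₂
  exact bias_injOn (Ioo_subset_Icc_self hx) (Ioo_subset_Icc_self hx')
    (eq_of_mulArtanh_ratio_eq hb hc hb' hc' e₁ e₂)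

/-- A continuous function without interior local minima on a rectangle is bounded below by its
boundary values. -/
theorem le_of_le_boundary {F : ℝ → ℝ → ℝ} {A B c : ℝ} (hF : Continuous fun p : ℝ × ℝ => F p.1 p.2)
    (hno : ∀ u ∈ Ioo 0 A, ∀ v ∈ Ioo 0 B, IsLocalMin (fun t => F t v) u →
      ¬ IsLocalMin (fun t => F u t) v)
    (hb : ∀ u ∈ Icc 0 A, ∀ v ∈ Icc 0 B, (u = 0 ∨ u = A) ∨ (v = 0 ∨ v = B) → c ≤ F u v)
    {u v : ℝ} (hu : u ∈ Icc 0 A) (hv : v ∈ Icc 0 B) : c ≤ F u v := by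
  obtain ⟨⟨a, b⟩, ⟨ha, hb'⟩, hmin⟩ := (isCompact_Icc.prod isCompact_Icc).exists_isMinOn
    ⟨(u, v), (⟨hu, hv⟩ : (u, v) ∈ Icc (0 : ℝ) A ×ˢ Icc (0 : ℝ) B)⟩ hF.continuousOn
  have hle : F a b ≤ F u v := hmin (⟨hu, hv⟩ : (u, v) ∈ Icc (0 : ℝ) A ×ˢ Icc (0 : ℝ) B)
  refine le_trans ?_ hle
  by_cases h : (a = 0 ∨ a = A) ∨ (b = 0 ∨ b = B)
  · exact hb a ha b hb' h
  push Not at h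
  have ha' : a ∈ Ioo 0 A := ⟨ha.1.lt_of_ne h.1.1.symm, ha.2.lt_of_ne h.1.2⟩
  have hbb : b ∈ Ioo 0 B := ⟨hb'.1.lt_of_ne h.2.1.symm, hb'.2.lt_of_ne h.2.2⟩
  refine (hno a ha' b hbb ?_ ?_).elim
  · filter_upwards [Ioo_mem_nhds ha'.1 ha'.2] with t ht
    exact hmin (⟨Ioo_subset_Icc_self ht, hb'⟩ : (t, b) ∈ Icc (0 : ℝ) A ×ˢ Icc (0 : ℝ) B)
  · filter_upwards [Ioo_mem_nhds hbb.1 hbb.2] with t ht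
    exact hmin (⟨ha, Ioo_subset_Icc_self ht⟩ : (a, t) ∈ Icc (0 : ℝ) A ×ˢ Icc (0 : ℝ) B)

/-- The increments `gerber (u + a) (v + b) - gerber u v` have no critical point, by injectivity of
the gradient. -/
theorem not_isLocalExtr_gerber_sub {u v a b : ℝ} (hu : 0 < u) (hv : 0 < v) (ha : 0 < a)
    (hb : 0 < b) (hua : u + a < log 2) (hvb : v + b < log 2)
    (h₁ : IsLocalExtr (fun t => gerber (t + a) (v + b) - gerber t v) u)
    (h₂ : IsLocalExtr (fun t => gerber (u + a) (t + b) - gerber u t) v) : False := by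
  have d₁ := (hasDerivAt_gerber (x := u) ⟨hu, by linarith⟩ v)
  have d₁' := (hasDerivAt_gerber (x := u + a) ⟨by linarith, hua⟩ (v + b))
  have d₂ := (hasDerivAt_gerber (x := v) ⟨hv, by linarith⟩ u)
  have d₂' := (hasDerivAt_gerber (x := v + b) ⟨by linarith, hvb⟩ (u + a))
  simp only [gerber_comm u, gerber_comm (u + a)] at h₂
  have z₁ := h₁.hasDerivAt_eq_zero ((d₁'.comp_add_const u a).sub d₁)
  have z₂ := h₂.hasDerivAt_eq_zero ((d₂'.comp_add_const v b).sub d₂)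
  rw [sub_eq_zero] at z₁ z₂
  rw [z₁] at d₁'
  rw [z₂] at d₂'
  have := eq_of_gerber_deriv_eq (x := u) (y := v) (x' := u + a) (y' := v + b)
    ⟨hu, by linarith⟩ ⟨hv, by linarith⟩ ⟨by linarith, hua⟩ ⟨by linarith, hvb⟩ d₁ d₂ d₁' d₂'
  linarith

theorem continuous_gerber_sub (a b : ℝ) :
    Continuous fun p : ℝ × ℝ => gerber (p.1 + a) (p.2 + b) - gerber p.1 p.2 :=
  (continuous_gerber.comp (by fun_prop : Continuous fun p : ℝ × ℝ => (p.1 + a, p.2 + b))).sub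
    continuous_gerber

/-- Subadditivity of the binary function on the square `[0, log 2]²`. -/
theorem gerber_add_add_le {u v a b : ℝ} (hu : 0 ≤ u) (hv : 0 ≤ v) (ha : 0 ≤ a) (hb : 0 ≤ b)
    (hua : u + a ≤ log 2) (hvb : v + b ≤ log 2) :
    gerber (u + a) (v + b) ≤ gerber u v + gerber a b := by
  rcases ha.eq_or_lt with rfl | ha'
  · rw [gerber_zero_left ⟨hb, by linarith⟩, add_zero, gerber_comm, gerber_comm u]
    exact gerber_add_le hv hb hvb u
  rcases hb.eq_or_lt with rfl | hb'
  · rw [gerber_comm a, gerber_zero_left ⟨ha, by linarith⟩, add_zero]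
    exact gerber_add_le hu ha hua v
  suffices -gerber a b ≤ -(gerber (u + a) (v + b) - gerber u v) by linarith
  refine le_of_le_boundary (F := fun u v => -(gerber (u + a) (v + b) - gerber u v))
    (A := log 2 - a) (B := log 2 - b) (continuous_gerber_sub a b).neg (fun u hu v hv h₁ h₂ => ?_)
    (fun u hu v hv h => ?_) ⟨hu, by linarith⟩ ⟨hv, by linarith⟩
  · exact not_isLocalExtr_gerber_sub hu.1 hv.1 ha' hb' (by linarith [hu.2]) (by linarith [hv.2])
      (Or.inr (by have := h₁.neg; simp only [neg_neg] at this; exact this))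
      (Or.inr (by have := h₂.neg; simp only [neg_neg] at this; exact this))
  · simp only [neg_sub, neg_le_sub_iff_le_add]
    have hga := left_le_gerber (x := a) ⟨ha, by linarith⟩ b
    have hgb := right_le_gerber (y := b) ⟨hb, by linarith⟩ a
    have hgu := left_le_gerber (x := u) ⟨hu.1, by linarith [hu.2]⟩ v
    have hgv := right_le_gerber (y := v) ⟨hv.1, by linarith [hv.2]⟩ u
    rcases h with (rfl | rfl) | (rfl | rfl)
    · rw [gerber_zero_left ⟨hv.1, by linarith [hv.2]⟩, zero_add, gerber_comm, gerber_comm a,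
        add_comm v, add_comm v]
      exact gerber_add_le hb hv.1 (by linarith [hv.2]) a
    · rw [sub_add_cancel, gerber_log_two_left]; linarith
    · rw [gerber_comm u, gerber_zero_left ⟨hu.1, by linarith [hu.2]⟩, zero_add, add_comm u,
        add_comm u]
      exact gerber_add_le ha hu.1 (by linarith [hu.2]) b
    · rw [sub_add_cancel, gerber_comm _ (log 2), gerber_log_two_left]; linarith

/-- Subadditivity of the binary function across the corner of the square `[0, log 2]²`: here the
sums of the arguments exceed `log 2`. -/
theorem log_two_add_gerber_le {u v a b : ℝ} (hu : 0 ≤ u) (hv : 0 ≤ v) (ha : 0 ≤ a) (hb : 0 ≤ b)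
    (hua : u + a ≤ log 2) (hvb : v + b ≤ log 2) :
    log 2 + gerber u v ≤ gerber (u + a) (v + b) + gerber (log 2 - a) (log 2 - b) := by
  rcases ha.eq_or_lt with rfl | ha'
  · rw [sub_zero, gerber_log_two_left, gerber_comm u, gerber_comm (u + 0), add_zero]
    linarith [gerber_mono (by linarith : v ≤ v + b) u]
  rcases hb.eq_or_lt with rfl | hb'
  · rw [sub_zero, gerber_comm _ (log 2), gerber_log_two_left, add_zero]
    linarith [gerber_mono (by linarith : u ≤ u + a) v]
  suffices log 2 - gerber (log 2 - a) (log 2 - b) ≤ gerber (u + a) (v + b) - gerber u v by linarith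
  refine le_of_le_boundary (F := fun u v => gerber (u + a) (v + b) - gerber u v)
    (A := log 2 - a) (B := log 2 - b) (continuous_gerber_sub a b) (fun u hu v hv h₁ h₂ => ?_)
    (fun u hu v hv h => ?_) ⟨hu, by linarith⟩ ⟨hv, by linarith⟩
  · exact not_isLocalExtr_gerber_sub hu.1 hv.1 ha' hb' (by linarith [hu.2]) (by linarith [hv.2])
      (Or.inl h₁) (Or.inl h₂)
  · have hga := left_le_gerber (x := log 2 - a) ⟨by linarith, by linarith⟩ (log 2 - b)
    have hgb := right_le_gerber (y := log 2 - b) ⟨by linarith, by linarith⟩ (log 2 - a)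
    have hgu := left_le_gerber (x := u + a) ⟨by linarith [hu.1], by linarith [hu.2]⟩ (v + b)
    have hgv := right_le_gerber (y := v + b) ⟨by linarith [hv.1], by linarith [hv.2]⟩ (u + a)
    rcases h with (rfl | rfl) | (rfl | rfl)
    · rw [gerber_zero_left ⟨hv.1, by linarith [hv.2]⟩]; linarith
    · rw [sub_add_cancel, gerber_log_two_left, gerber_comm _ v, gerber_comm _ (log 2 - b)]
      linarith [gerber_mono hv.2 (log 2 - a)]
    · rw [gerber_comm u, gerber_zero_left ⟨hu.1, by linarith [hu.2]⟩]; linarith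
    · rw [sub_add_cancel, gerber_comm _ (log 2), gerber_log_two_left]
      linarith [gerber_mono hu.2 (log 2 - b)]

/-! ### The function `f_G` in closed form -/

/-- The closed form of `f_G`, for any `G` of order a power of two: the binary function on the
diagonal boxes `[k log 2, (k + 1) log 2]²`, and the maximum off these boxes. -/
noncomputable def boxGerber (x y : ℝ) : ℝ :=
  if ⌊x / log 2⌋ = ⌊y / log 2⌋ then
    ⌊x / log 2⌋ * log 2 + gerber (x - ⌊x / log 2⌋ * log 2) (y - ⌊x / log 2⌋ * log 2)
  else max x y

theorem boxGerber_comm (x y : ℝ) : boxGerber x y = boxGerber y x := by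
  unfold boxGerber
  by_cases h : ⌊x / log 2⌋ = ⌊y / log 2⌋
  · rw [if_pos h, if_pos h.symm, gerber_comm, h]
  · rw [if_neg h, if_neg (Ne.symm h), max_comm]

theorem floor_div_log_two (x : ℝ) :
    ⌊x / log 2⌋ * log 2 ≤ x ∧ x < (⌊x / log 2⌋ + 1) * log 2 :=
  ⟨(le_div_iff₀ log_two_pos).1 (Int.floor_le _),
    (div_lt_iff₀ log_two_pos).1 (Int.lt_floor_add_one _)⟩

theorem floor_div_log_two_eq {x : ℝ} {k : ℤ} (h₁ : k * log 2 ≤ x) (h₂ : x < (k + 1) * log 2) :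
    ⌊x / log 2⌋ = k :=
  Int.floor_eq_iff.2 ⟨(le_div_iff₀ log_two_pos).2 h₁, (div_lt_iff₀ log_two_pos).2 h₂⟩

theorem boxGerber_of_mem_box {x y : ℝ} {k : ℤ} (hx : k * log 2 ≤ x) (hx' : x < (k + 1) * log 2)
    (hy : k * log 2 ≤ y) (hy' : y < (k + 1) * log 2) :
    boxGerber x y = k * log 2 + gerber (x - k * log 2) (y - k * log 2) := by
  unfold boxGerber
  rw [floor_div_log_two_eq hx hx', floor_div_log_two_eq hy hy', if_pos rfl]

theorem boxGerber_of_le_of_le {x y : ℝ} (k : ℤ) (hx : x ≤ k * log 2) (hy : k * log 2 ≤ y) :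
    boxGerber x y = y := by
  unfold boxGerber
  obtain ⟨hx₁, hx₂⟩ := floor_div_log_two x
  obtain ⟨hy₁, hy₂⟩ := floor_div_log_two y
  split_ifs with h
  · rw [← h] at hy₁ hy₂
    have h₁ : ⌊x / log 2⌋ ≤ k := by
      exact_mod_cast le_of_mul_le_mul_right (hx₁.trans hx) log_two_pos
    have h₂ : k < ⌊x / log 2⌋ + 1 := by
      exact_mod_cast lt_of_mul_lt_mul_right (hy.trans_lt hy₂) log_two_pos.le
    have h₃ : ⌊x / log 2⌋ = k := by omega
    rw [h₃] at hx₁ hx₂ hy₁ hy₂ ⊢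
    rw [le_antisymm hx hx₁, sub_self, gerber_zero_left ⟨by linarith, by linarith⟩]
    ring
  · exact max_eq_right (hx.trans hy)

theorem boxGerber_of_mem_closed_box {x y : ℝ} {k : ℤ} (hx : k * log 2 ≤ x)
    (hx' : x ≤ (k + 1) * log 2) (hy : k * log 2 ≤ y) (hy' : y ≤ (k + 1) * log 2) :
    boxGerber x y = k * log 2 + gerber (x - k * log 2) (y - k * log 2) := by
  rcases hx'.lt_or_eq with hx' | hx'
  · rcases hy'.lt_or_eq with hy' | hy'
    · exact boxGerber_of_mem_box hx hx' hy hy'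
    · rw [boxGerber_of_le_of_le (k + 1) (by push_cast; exact hx'.le) (by push_cast; exact hy'.ge),
        gerber_comm, hy', show (k + 1) * log 2 - k * log 2 = log 2 by ring, gerber_log_two_left]
      ring
  · rw [boxGerber_comm,
      boxGerber_of_le_of_le (k + 1) (by push_cast; exact hy') (by push_cast; exact hx'.ge),
      hx', show (k + 1) * log 2 - k * log 2 = log 2 by ring, gerber_log_two_left]
    ring

theorem left_le_boxGerber (x y : ℝ) : x ≤ boxGerber x y := by
  unfold boxGerber
  obtain ⟨h₁, h₂⟩ := floor_div_log_two x
  split_ifs with h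
  · have := left_le_gerber (x := x - ⌊x / log 2⌋ * log 2) ⟨by linarith, by linarith⟩
      (y - ⌊x / log 2⌋ * log 2)
    linarith
  · exact le_max_left _ _

theorem right_le_boxGerber (x y : ℝ) : y ≤ boxGerber x y := by
  rw [boxGerber_comm]; exact left_le_boxGerber y x

/-- Convexity of the closed form in one argument, as the existence of supporting lines. -/
theorem boxGerber_support (x₀ y : ℝ) :
    ∃ m, ∀ x, boxGerber x₀ y + m * (x - x₀) ≤ boxGerber x y := by
  obtain ⟨hy₁, hy₂⟩ := floor_div_log_two y
  set k := ⌊y / log 2⌋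
  have hR : ∀ x, (k + 1) * log 2 ≤ x → boxGerber x y = x := fun x hx => by
    rw [boxGerber_comm]
    exact boxGerber_of_le_of_le (k + 1) (by push_cast; exact hy₂.le) (by push_cast; exact hx)
  rcases le_or_gt x₀ (k * log 2) with h | h
  · refine ⟨0, fun x => ?_⟩
    rw [boxGerber_of_le_of_le k h hy₁]
    linarith [right_le_boxGerber x y]
  rcases le_or_gt ((k + 1) * log 2) x₀ with h' | h'
  · refine ⟨1, fun x => ?_⟩
    rw [hR x₀ h']
    linarith [left_le_boxGerber x y]
  obtain ⟨m, hm, hs⟩ := gerber_support (x₀ := x₀ - k * log 2) ⟨by linarith, by linarith⟩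
    (y - k * log 2)
  refine ⟨m, fun x => ?_⟩
  rw [boxGerber_of_mem_box h.le h' hy₁ hy₂]
  rcases le_or_gt x (k * log 2) with hx | hx
  · rw [boxGerber_of_le_of_le k hx hy₁]
    have := hs 0 ⟨le_rfl, log_two_pos.le⟩
    rw [gerber_zero_left ⟨by linarith, by linarith⟩] at this
    nlinarith [mul_nonneg hm.1 (sub_nonneg.2 hx)]
  rcases le_or_gt ((k + 1) * log 2) x with hx' | hx'
  · rw [hR x hx']
    have := hs (log 2) ⟨log_two_pos.le, le_rfl⟩
    rw [gerber_log_two_left] at this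
    nlinarith [mul_nonneg (sub_nonneg.2 hm.2) (sub_nonneg.2 hx')]
  · rw [boxGerber_of_mem_box hx.le hx' hy₁ hy₂]
    have := hs (x - k * log 2) ⟨by linarith, by linarith⟩
    rw [sub_sub_sub_cancel_right] at this
    linarith

/-- Convexity of the closed form in one argument, for mixtures of two points. -/
theorem boxGerber_two_point {a b : ℝ} (ha : 0 ≤ a) (hb : 0 ≤ b) (hab : a + b = 1) (x₁ x₂ y : ℝ) :
    boxGerber (a * x₁ + b * x₂) y ≤ a * boxGerber x₁ y + b * boxGerber x₂ y := by
  obtain ⟨m, hm⟩ := boxGerber_support (a * x₁ + b * x₂) y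
  have h₁ := mul_le_mul_of_nonneg_left (hm x₁) ha
  have h₂ := mul_le_mul_of_nonneg_left (hm x₂) hb
  obtain rfl : b = 1 - a := by linarith
  linarith

/-- The case of `boxGerber_add_add_le` in which `x` and `y` are separated by a multiple `K` of
`log 2`. -/
theorem gerber_sub_add_le {u v x y K : ℝ} (hv : 0 ≤ v) (hx : x ≤ K)
    (hy : K ≤ y) (hyv : y + v ≤ K + log 2) :
    K + gerber (x + u - K) (y + v - K) ≤ gerber u v + y := by
  have h₁ := gerber_mono (by linarith : x + u - K ≤ u) (y + v - K)
  have h₂ := gerber_add_le hv (sub_nonneg.2 hy) (by linarith) u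
  rw [gerber_comm _ u, gerber_comm _ u, show v + (y - K) = y + v - K by ring] at h₂
  linarith

/-- The closed form satisfies the triangle inequality that corresponds to splitting off one bit:
`u`, `v` are the entropies of the cosets, `x`, `y` the conditional entropies within them. -/
theorem boxGerber_add_add_le {u v : ℝ} (hu : u ∈ Icc 0 (log 2)) (hv : v ∈ Icc 0 (log 2))
    (x y : ℝ) : boxGerber (u + x) (v + y) ≤ gerber u v + boxGerber x y := by
  rw [add_comm u, add_comm v]
  have hgu := left_le_gerber hu v
  have hgv := right_le_gerber hv u
  have hbx := left_le_boxGerber x y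
  have hby := right_le_boxGerber x y
  by_cases h : ⌊(x + u) / log 2⌋ = ⌊(y + v) / log 2⌋
  swap
  · rw [boxGerber, if_neg h]
    exact max_le (by linarith) (by linarith)
  obtain ⟨hx₁, hx₂⟩ := floor_div_log_two (x + u)
  obtain ⟨hy₁, hy₂⟩ := floor_div_log_two (y + v)
  rw [← h] at hy₁ hy₂
  set k := ⌊(x + u) / log 2⌋
  rw [boxGerber_of_mem_box hx₁ hx₂ hy₁ hy₂]
  obtain ⟨hu₁, hu₂⟩ := hu
  obtain ⟨hv₁, hv₂⟩ := hv
  rcases le_or_gt (k * log 2) x with hx | hx <;> rcases le_or_gt (k * log 2) y with hy | hy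
  · rw [boxGerber_of_mem_box hx (by linarith) hy (by linarith)]
    have := gerber_add_add_le hu₁ hv₁ (sub_nonneg.2 hx) (sub_nonneg.2 hy) (by linarith)
      (by linarith)
    rw [show u + (x - k * log 2) = x + u - k * log 2 by ring,
      show v + (y - k * log 2) = y + v - k * log 2 by ring] at this
    linarith
  · rw [boxGerber_comm, boxGerber_of_le_of_le k hy.le hx, gerber_comm, gerber_comm u]
    exact gerber_sub_add_le hu₁ hy.le hx (by linarith)
  · rw [boxGerber_of_le_of_le k hx.le hy]
    exact gerber_sub_add_le hv₁ hx.le hy (by linarith)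
  · rw [boxGerber_of_mem_box (k := k - 1) (by push_cast; linarith) (by push_cast; linarith)
      (by push_cast; linarith) (by push_cast; linarith)]
    have := log_two_add_gerber_le (sub_nonneg.2 hx₁) (sub_nonneg.2 hy₁) (sub_nonneg.2 hx.le)
      (sub_nonneg.2 hy.le) (by linarith) (by linarith)
    rw [show x + u - k * log 2 + (k * log 2 - x) = u by ring,
      show y + v - k * log 2 + (k * log 2 - y) = v by ring,
      show log 2 - (k * log 2 - x) = x - (k - 1) * log 2 by ring,
      show log 2 - (k * log 2 - y) = y - (k - 1) * log 2 by ring] at this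
    push_cast
    linarith

/-! ### Entropy of probability vectors -/

/-- The entropy of a vector of point masses. -/
noncomputable def vecEntropy {ι : Type*} [Fintype ι] (v : ι → ℝ) : ℝ := ∑ i, negMulLog (v i)

section Vectors

variable {ι : Type*} [Fintype ι]

theorem vecEntropy_nonneg {v : ι → ℝ} (hv : v ∈ stdSimplex ℝ ι) : 0 ≤ vecEntropy v :=
  Finset.sum_nonneg fun i _ => negMulLog_nonneg (hv.1 i)
    (by rw [← hv.2]; exact Finset.single_le_sum (fun j _ => hv.1 j) (Finset.mem_univ i))

theorem uniform_mem_stdSimplex [Nonempty ι] :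
    (fun _ : ι => (Fintype.card ι : ℝ)⁻¹) ∈ stdSimplex ℝ ι := by
  have : (0 : ℝ) < Fintype.card ι := by exact_mod_cast Fintype.card_pos
  exact ⟨fun _ => by positivity, by simp [this.ne']⟩

theorem vecEntropy_uniform [Nonempty ι] :
    vecEntropy (fun _ : ι => (Fintype.card ι : ℝ)⁻¹) = log (Fintype.card ι) := by
  have : (0 : ℝ) < Fintype.card ι := by exact_mod_cast Fintype.card_pos
  simp only [vecEntropy, Finset.sum_const, Finset.card_univ, nsmul_eq_mul, negMulLog, log_inv]
  field_simp

theorem vecEntropy_le_log_card [Nonempty ι] {v : ι → ℝ} (hv : v ∈ stdSimplex ℝ ι) :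
    vecEntropy v ≤ log (Fintype.card ι) := by
  have hc : (0 : ℝ) < Fintype.card ι := by exact_mod_cast Fintype.card_pos
  have h := concaveOn_negMulLog.le_map_sum (t := Finset.univ)
    (w := fun _ : ι => (Fintype.card ι : ℝ)⁻¹) (p := v) (fun i _ => by positivity)
    (by simp [hc.ne']) fun i _ => hv.1 i
  simp only [smul_eq_mul, ← Finset.mul_sum, hv.2, mul_one] at h
  rw [inv_mul_le_iff₀ hc] at h
  refine h.trans_eq ?_
  simp only [negMulLog, log_inv]
  field_simp

theorem exists_eq_sum_mul [Nonempty ι] {w : ι → ℝ} (hw : ∀ i, 0 ≤ w i) :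
    ∃ v ∈ stdSimplex ℝ ι, ∀ i, w i = (∑ j, w j) * v i := by
  rcases (Finset.sum_nonneg fun i _ => hw i).eq_or_lt with h | h
  · refine ⟨_, uniform_mem_stdSimplex, fun i => ?_⟩
    rw [← h, zero_mul]
    exact (Finset.sum_eq_zero_iff_of_nonneg fun i _ => hw i).1 h.symm i (Finset.mem_univ i)
  · refine ⟨fun i => w i / ∑ j, w j, ⟨fun i => div_nonneg (hw i) h.le, ?_⟩, fun i => ?_⟩
    · rw [← Finset.sum_div, div_self h.ne']
    · field_simp

theorem sum_negMulLog_mul {v : ι → ℝ} (hv : v ∈ stdSimplex ℝ ι) (a : ℝ) :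
    ∑ i, negMulLog (a * v i) = negMulLog a + a * vecEntropy v := by
  simp only [negMulLog_mul, Finset.sum_add_distrib, ← Finset.sum_mul, ← Finset.mul_sum, hv.2,
    vecEntropy, one_mul]

/-- Concavity of entropy, for an unnormalized mixture. -/
theorem le_sum_negMulLog_add {v w : ι → ℝ} (hv : v ∈ stdSimplex ℝ ι) (hw : w ∈ stdSimplex ℝ ι)
    {a b : ℝ} (ha : 0 ≤ a) (hb : 0 ≤ b) :
    negMulLog (a + b) + (a * vecEntropy v + b * vecEntropy w) ≤
      ∑ i, negMulLog (a * v i + b * w i) := by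
  rcases (add_nonneg ha hb).eq_or_lt with h | h
  · obtain rfl : a = 0 := by linarith
    obtain rfl : b = 0 := by linarith
    simp
  have hl : 0 ≤ a / (a + b) := by positivity
  have hm : 0 ≤ b / (a + b) := by positivity
  have hlm : a / (a + b) + b / (a + b) = 1 := by field_simp
  have hmem := convex_stdSimplex ℝ ι hv hw hl hm hlm
  have e : ∑ i, negMulLog (a * v i + b * w i) =
      ∑ i, negMulLog ((a + b) * ((a / (a + b)) • v + (b / (a + b)) • w) i) := by
    refine Finset.sum_congr rfl fun i _ => ?_
    simp only [Pi.add_apply, Pi.smul_apply, smul_eq_mul]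
    congr 1
    field_simp
  rw [e, sum_negMulLog_mul hmem]
  have hcv : a / (a + b) * vecEntropy v + b / (a + b) * vecEntropy w ≤
      vecEntropy ((a / (a + b)) • v + (b / (a + b)) • w) := by
    simp only [vecEntropy, Finset.mul_sum, ← Finset.sum_add_distrib]
    exact Finset.sum_le_sum fun i _ => concaveOn_negMulLog.2 (hv.1 i) (hw.1 i) hl hm hlm
  have h' := mul_le_mul_of_nonneg_left hcv h.le
  have e' : (a + b) * (a / (a + b) * vecEntropy v + b / (a + b) * vecEntropy w) =
      a * vecEntropy v + b * vecEntropy w := by field_simp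
  linarith

end Vectors

theorem biasEntropy_abs (t : ℝ) : biasEntropy |t| = biasEntropy t := by
  rcases abs_choice t with h | h
  · rw [h]
  · rw [h, biasEntropy, biasEntropy, ← binEntropy_one_sub]
    congr 1
    ring

theorem negMulLog_add_negMulLog {a b : ℝ} (h : a + b = 1) :
    negMulLog a + negMulLog b = biasEntropy (a - b) := by
  obtain rfl : a = 1 - b := by linarith
  rw [biasEntropy, show (1 - (1 - b - b)) / 2 = b by ring,
    binEntropy_eq_negMulLog_add_negMulLog_one_sub, add_comm]

theorem abs_sub_mem {a b : ℝ} (ha : 0 ≤ a) (hb : 0 ≤ b) (h : a + b = 1) :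
    |a - b| ∈ Icc (0 : ℝ) 1 :=
  ⟨abs_nonneg _, abs_le.2 ⟨by linarith, by linarith⟩⟩

theorem negMulLog_add_mem {a b : ℝ} (ha : 0 ≤ a) (hb : 0 ≤ b) (h : a + b = 1) :
    negMulLog a + negMulLog b ∈ Icc 0 (log 2) := by
  rw [negMulLog_add_negMulLog h, ← biasEntropy_abs]
  exact biasEntropy_mem (abs_sub_mem ha hb h)

/-- The entropy of the sum of two independent bits is given by the binary function. -/
theorem gerber_negMulLog {a b a' b' : ℝ} (ha : 0 ≤ a) (hb : 0 ≤ b) (h : a + b = 1)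
    (ha' : 0 ≤ a') (hb' : 0 ≤ b') (h' : a' + b' = 1) :
    gerber (negMulLog a + negMulLog b) (negMulLog a' + negMulLog b') =
      negMulLog (a * a' + b * b') + negMulLog (a * b' + b * a') := by
  have e : a * a' + b * b' + (a * b' + b * a') = 1 := by
    have : a * a' + b * b' + (a * b' + b * a') = (a + b) * (a' + b') := by ring
    rw [this, h, h', one_mul]
  rw [negMulLog_add_negMulLog h, negMulLog_add_negMulLog h', negMulLog_add_negMulLog e,
    ← biasEntropy_abs, ← biasEntropy_abs (a' - b'),
    gerber_biasEntropy (abs_sub_mem ha hb h) (abs_sub_mem ha' hb' h'), ← abs_mul, biasEntropy_abs]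
  congr 1
  ring

theorem exists_negMulLog_add_eq {x : ℝ} (hx : x ∈ Icc 0 (log 2)) :
    ∃ a b : ℝ, 0 ≤ a ∧ 0 ≤ b ∧ a + b = 1 ∧ negMulLog a + negMulLog b = x := by
  have hb := bias_mem x
  refine ⟨(1 + bias x) / 2, (1 - bias x) / 2, by linarith [hb.1], by linarith [hb.2], by ring, ?_⟩
  rw [negMulLog_add_negMulLog (by ring),
    show (1 + bias x) / 2 - (1 - bias x) / 2 = bias x by ring, biasEntropy_bias hx]

/-! ### Convolution along a subgroup of index two -/

/-- The convolution of two vectors of point masses. -/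
def vecConv {G : Type*} [AddCommGroup G] [Fintype G] (p q : G → ℝ) (g : G) : ℝ :=
  ∑ a, p a * q (g - a)

theorem exists_index_two {G : Type*} [AddCommGroup G] [Finite G] {n : ℕ}
    (hG : Nat.card G = 2 ^ (n + 1)) :
    ∃ (H : AddSubgroup G) (c : G), Nat.card H = 2 ^ n ∧ c ∉ H ∧ ∀ g ∉ H, g - c ∈ H := by
  have hG' : Nat.card (Multiplicative G) = 2 ^ (n + 1) := by
    rw [← hG]; exact Nat.card_congr Multiplicative.toAdd
  obtain ⟨K, hK⟩ := Sylow.exists_subgroup_card_pow_prime (G := Multiplicative G) 2 (n := n)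
    (by rw [hG']; exact pow_dvd_pow 2 n.le_succ)
  have hH : Nat.card (Subgroup.toAddSubgroup' K) = 2 ^ n := hK
  have hi : (Subgroup.toAddSubgroup' K).index = 2 := by
    have := (Subgroup.toAddSubgroup' K).card_mul_index
    rw [hH, hG, pow_succ] at this
    exact Nat.eq_of_mul_eq_mul_left (by positivity) this
  generalize Subgroup.toAddSubgroup' K = H at hH hi
  obtain ⟨a, ha⟩ := AddSubgroup.index_eq_two_iff.1 hi
  have ha0 : a ∉ H := fun h => by
    rcases ha 0 with h' | h'
    · exact h'.2 H.zero_mem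
    · exact h'.2 (by rwa [zero_add])
  refine ⟨H, -a, hH, fun h => ha0 (by simpa using H.neg_mem h), fun g hg => ?_⟩
  rcases ha g with h' | h'
  · simpa using h'.1
  · exact (hg h'.1).elim

theorem add_self_mem {G : Type*} [AddCommGroup G] {H : AddSubgroup G} {c : G} (hc : c ∉ H)
    (hH : ∀ g ∉ H, g - c ∈ H) : c + c ∈ H := by
  by_contra h
  exact hc (by simpa using hH _ h)

section Conv

variable {G : Type*} [AddCommGroup G] [Fintype G]

theorem vecConv_comm (p q : G → ℝ) : vecConv p q = vecConv q p := by
  funext g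
  refine Fintype.sum_equiv (Equiv.subLeft g) _ _ fun a => ?_
  simp [mul_comm]

theorem vecConv_mem {p q : G → ℝ} (hp : p ∈ stdSimplex ℝ G) (hq : q ∈ stdSimplex ℝ G) :
    vecConv p q ∈ stdSimplex ℝ G := by
  refine ⟨fun g => Finset.sum_nonneg fun a _ => mul_nonneg (hp.1 a) (hq.1 _), ?_⟩
  unfold vecConv
  rw [Finset.sum_comm]
  have : ∀ a, ∑ g, p a * q (g - a) = p a := fun a => by
    rw [← Finset.mul_sum, Fintype.sum_equiv (Equiv.subRight a) (fun g => q (g - a)) q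
      fun g => rfl, hq.2, mul_one]
  simp only [this, hp.2]

theorem vecConv_const {p : G → ℝ} (hp : p ∈ stdSimplex ℝ G) (c : ℝ) :
    vecConv p (fun _ => c) = fun _ => c := by
  funext g
  rw [vecConv, ← Finset.sum_mul, hp.2, one_mul]

theorem vecEntropy_sub_right (v : G → ℝ) (e : G) : vecEntropy (fun g => v (g - e)) = vecEntropy v :=
  Fintype.sum_equiv (Equiv.subRight e) _ _ fun _ => rfl

theorem sub_mem_stdSimplex {v : G → ℝ} (hv : v ∈ stdSimplex ℝ G) (e : G) :
    (fun g => v (g - e)) ∈ stdSimplex ℝ G :=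
  ⟨fun _ => hv.1 _, by rw [← hv.2]; exact Fintype.sum_equiv (Equiv.subRight e) _ _ fun _ => rfl⟩

variable {H : AddSubgroup G} [Fintype H] {c : G}

theorem sum_eq_sum_add_sum_coset (hc : c ∉ H) (hH : ∀ g ∉ H, g - c ∈ H) (F : G → ℝ) :
    ∑ g, F g = ∑ h : H, F h + ∑ h : H, F (c + h) := by
  classical
  rw [← Finset.sum_filter_add_sum_filter_not Finset.univ (· ∈ H) F]
  congr 1
  · refine (Finset.sum_subtype _ (fun g => by simp) F)
  · symm
    refine Finset.sum_bij' (fun h _ => c + h) (fun g hg => ⟨g - c, hH g (by simpa using hg)⟩)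
      (fun h _ => ?_) (fun _ _ => Finset.mem_univ _) (fun h _ => ?_) (fun g _ => ?_)
      fun _ _ => rfl
    · simp only [Finset.mem_filter, Finset.mem_univ, true_and]
      exact fun h' => hc (by simpa using H.sub_mem h' h.2)
    · simp
    · simp

/-- The chain rule: the entropy of the coset plus the conditional entropy within it. -/
theorem vecEntropy_eq_of_coset (hc : c ∉ H) (hH : ∀ g ∉ H, g - c ∈ H) {p : G → ℝ} {a b : ℝ}
    {v w : H → ℝ} (hv : v ∈ stdSimplex ℝ H) (hw : w ∈ stdSimplex ℝ H)
    (hp₀ : ∀ h : H, p h = a * v h) (hp₁ : ∀ h : H, p (c + h) = b * w h) :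
    vecEntropy p = negMulLog a + negMulLog b + (a * vecEntropy v + b * vecEntropy w) := by
  rw [vecEntropy, sum_eq_sum_add_sum_coset hc hH]
  simp only [hp₀, hp₁, sum_negMulLog_mul hv, sum_negMulLog_mul hw]
  ring

/-- Disintegration of a law along the two cosets into weights and conditional laws. The conditional
law on a coset of weight zero is arbitrary. -/
theorem exists_coset_split (hc : c ∉ H) (hH : ∀ g ∉ H, g - c ∈ H) {p : G → ℝ}
    (hp : p ∈ stdSimplex ℝ G) :
    ∃ (a b : ℝ) (v w : H → ℝ), 0 ≤ a ∧ 0 ≤ b ∧ a + b = 1 ∧ v ∈ stdSimplex ℝ H ∧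
      w ∈ stdSimplex ℝ H ∧ (∀ h : H, p h = a * v h) ∧ ∀ h : H, p (c + h) = b * w h := by
  obtain ⟨v, hv, hv'⟩ := exists_eq_sum_mul (w := fun h : H => p h) fun h => hp.1 _
  obtain ⟨w, hw, hw'⟩ := exists_eq_sum_mul (w := fun h : H => p (c + h)) fun h => hp.1 _
  exact ⟨_, _, v, w, Finset.sum_nonneg fun h _ => hp.1 _, Finset.sum_nonneg fun h _ => hp.1 _,
    by rw [← sum_eq_sum_add_sum_coset hc hH, hp.2], hv, hw, hv', hw'⟩

theorem exists_of_coset_split (hc : c ∉ H) (hH : ∀ g ∉ H, g - c ∈ H) {a b : ℝ} (ha : 0 ≤ a)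
    (hb : 0 ≤ b) (hab : a + b = 1) {v w : H → ℝ} (hv : v ∈ stdSimplex ℝ H)
    (hw : w ∈ stdSimplex ℝ H) :
    ∃ p ∈ stdSimplex ℝ G, (∀ h : H, p h = a * v h) ∧ ∀ h : H, p (c + h) = b * w h := by
  classical
  have h₀ : ∀ h : H, (if hg : (h : G) ∈ H then a * v ⟨h, hg⟩ else b * w ⟨h - c, hH h hg⟩) =
      a * v h := fun h => by rw [dif_pos h.2]
  have h₁ : ∀ h : H, (if hg : c + (h : G) ∈ H then a * v ⟨c + h, hg⟩
      else b * w ⟨c + h - c, hH _ hg⟩) = b * w h := fun h => by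
    rw [dif_neg fun h' => hc (by simpa using H.sub_mem h' h.2)]
    congr 2
    exact Subtype.ext (by simp)
  refine ⟨fun g => if hg : g ∈ H then a * v ⟨g, hg⟩ else b * w ⟨g - c, hH g hg⟩,
    ⟨fun g => ?_, ?_⟩, h₀, h₁⟩
  · dsimp only
    split_ifs
    · exact mul_nonneg ha (hv.1 _)
    · exact mul_nonneg hb (hw.1 _)
  · rw [sum_eq_sum_add_sum_coset hc hH]
    simp only [h₀, h₁, ← Finset.mul_sum, hv.2, hw.2, mul_one, hab]

theorem vecConv_coset_zero (hc : c ∉ H) (hH : ∀ g ∉ H, g - c ∈ H) (he : c + c ∈ H)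
    {p q : G → ℝ} {a b a' b' : ℝ} {v w v' w' : H → ℝ} (hp₀ : ∀ h : H, p h = a * v h)
    (hp₁ : ∀ h : H, p (c + h) = b * w h) (hq₀ : ∀ h : H, q h = a' * v' h)
    (hq₁ : ∀ h : H, q (c + h) = b' * w' h) (h : H) :
    vecConv p q h = a * a' * vecConv v v' h + b * b' * vecConv w w' (h - ⟨c + c, he⟩) := by
  rw [vecConv, sum_eq_sum_add_sum_coset hc hH, vecConv, vecConv, Finset.mul_sum, Finset.mul_sum]
  congr 1 <;> refine Finset.sum_congr rfl fun k _ => ?_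
  · rw [hp₀, ← AddSubgroup.coe_sub, hq₀]; ring
  · rw [hp₁, show (h : G) - (c + k) = c + ((h - ⟨c + c, he⟩ - k : H) : G) by push_cast; abel, hq₁]
    ring

theorem vecConv_coset_one (hc : c ∉ H) (hH : ∀ g ∉ H, g - c ∈ H)
    {p q : G → ℝ} {a b a' b' : ℝ} {v w v' w' : H → ℝ} (hp₀ : ∀ h : H, p h = a * v h)
    (hp₁ : ∀ h : H, p (c + h) = b * w h) (hq₀ : ∀ h : H, q h = a' * v' h)
    (hq₁ : ∀ h : H, q (c + h) = b' * w' h) (h : H) :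
    vecConv p q (c + h) = a * b' * vecConv v w' h + b * a' * vecConv w v' h := by
  rw [vecConv, sum_eq_sum_add_sum_coset hc hH, vecConv, vecConv, Finset.mul_sum, Finset.mul_sum]
  congr 1 <;> refine Finset.sum_congr rfl fun k _ => ?_
  · rw [hp₀, show c + (h : G) - k = c + ((h - k : H) : G) by push_cast; abel, hq₁]; ring
  · rw [hp₁, show c + (h : G) - (c + k) = ((h - k : H) : G) by push_cast; abel, hq₀]; ring

/-- The induction step of the lower bound: reveal the cosets of both summands. -/
theorem boxGerber_le_vecEntropy_of_subgroup (hc : c ∉ H) (hH : ∀ g ∉ H, g - c ∈ H)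
    (ih : ∀ v ∈ stdSimplex ℝ H, ∀ w ∈ stdSimplex ℝ H,
      boxGerber (vecEntropy v) (vecEntropy w) ≤ vecEntropy (vecConv v w))
    {p q : G → ℝ} (hp : p ∈ stdSimplex ℝ G) (hq : q ∈ stdSimplex ℝ G) :
    boxGerber (vecEntropy p) (vecEntropy q) ≤ vecEntropy (vecConv p q) := by
  obtain ⟨a, b, v, w, ha, hb, hab, hv, hw, hp₀, hp₁⟩ := exists_coset_split hc hH hp
  obtain ⟨a', b', v', w', ha', hb', hab', hv', hw', hq₀, hq₁⟩ := exists_coset_split hc hH hq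
  have he := add_self_mem hc hH
  have hvv := ih v hv v' hv'
  have hvw := ih v hv w' hw'
  have hwv := ih w hw v' hv'
  have hww := ih w hw w' hw'
  -- Each coset of the sum is reached from two pairs of cosets, and entropy is concave.
  have k₀ : negMulLog (a * a' + b * b') + (a * a' * vecEntropy (vecConv v v') +
      b * b' * vecEntropy (vecConv w w')) ≤ ∑ h : H, negMulLog (vecConv p q h) := by
    simp only [vecConv_coset_zero hc hH he hp₀ hp₁ hq₀ hq₁]
    rw [← vecEntropy_sub_right (vecConv w w') ⟨c + c, he⟩]
    exact le_sum_negMulLog_add (vecConv_mem hv hv') (sub_mem_stdSimplex (vecConv_mem hw hw') _)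
      (mul_nonneg ha ha') (mul_nonneg hb hb')
  have k₁ : negMulLog (a * b' + b * a') + (a * b' * vecEntropy (vecConv v w') +
      b * a' * vecEntropy (vecConv w v')) ≤ ∑ h : H, negMulLog (vecConv p q (c + h)) := by
    simp only [vecConv_coset_one hc hH hp₀ hp₁ hq₀ hq₁]
    exact le_sum_negMulLog_add (vecConv_mem hv hw') (vecConv_mem hw hv')
      (mul_nonneg ha hb') (mul_nonneg hb ha')
  have hsum : vecEntropy (vecConv p q) = _ := sum_eq_sum_add_sum_coset hc hH _
  rw [hsum, vecEntropy_eq_of_coset hc hH hv hw hp₀ hp₁,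
    vecEntropy_eq_of_coset hc hH hv' hw' hq₀ hq₁]
  have t := boxGerber_add_add_le (negMulLog_add_mem ha hb hab) (negMulLog_add_mem ha' hb' hab')
    (a * vecEntropy v + b * vecEntropy w) (a' * vecEntropy v' + b' * vecEntropy w')
  rw [gerber_negMulLog ha hb hab ha' hb' hab'] at t
  -- Convexity in both arguments averages the four bounds given by the induction hypothesis.
  have c₀ := boxGerber_two_point ha hb hab (vecEntropy v) (vecEntropy w)
    (a' * vecEntropy v' + b' * vecEntropy w')
  have c₁ := boxGerber_two_point ha' hb' hab' (vecEntropy v') (vecEntropy w') (vecEntropy v)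
  have c₂ := boxGerber_two_point ha' hb' hab' (vecEntropy v') (vecEntropy w') (vecEntropy w)
  simp only [boxGerber_comm _ (vecEntropy v), boxGerber_comm _ (vecEntropy w)] at c₀ c₁ c₂
  have d₁ := mul_le_mul_of_nonneg_left c₁ ha
  have d₂ := mul_le_mul_of_nonneg_left c₂ hb
  have f₁ := mul_le_mul_of_nonneg_left hvv (mul_nonneg ha ha')
  have f₂ := mul_le_mul_of_nonneg_left hvw (mul_nonneg ha hb')
  have f₃ := mul_le_mul_of_nonneg_left hwv (mul_nonneg hb ha')
  have f₄ := mul_le_mul_of_nonneg_left hww (mul_nonneg hb hb')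
  linarith

end Conv

/-! ### The closed form is the minimal entropy of a sum -/

universe u

/-- Mrs. Gerber's lemma for groups of order `2 ^ n`. -/
theorem boxGerber_le_vecEntropy (n : ℕ) : ∀ {G : Type u} [AddCommGroup G] [Fintype G],
    Fintype.card G = 2 ^ n → ∀ p ∈ stdSimplex ℝ G, ∀ q ∈ stdSimplex ℝ G,
      boxGerber (vecEntropy p) (vecEntropy q) ≤ vecEntropy (vecConv p q) := by
  induction n with
  | zero =>
    intro G _ _ hG p hp q hq
    have h0 : ∀ v ∈ stdSimplex ℝ G, vecEntropy v = 0 := fun v hv =>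
      le_antisymm (by simpa [hG] using vecEntropy_le_log_card hv) (vecEntropy_nonneg hv)
    rw [h0 p hp, h0 q hq, h0 _ (vecConv_mem hp hq),
      boxGerber_of_le_of_le 0 (by simp) (by simp)]
  | succ n ih =>
    intro G _ _ hG p hp q hq
    obtain ⟨H, c, hcard, hc, hH⟩ := exists_index_two (G := G) (by rw [Nat.card_eq_fintype_card, hG])
    have := Fintype.ofFinite H
    exact boxGerber_le_vecEntropy_of_subgroup hc hH
      (ih (by rw [← Nat.card_eq_fintype_card, hcard])) hp hq

/-- Given a subgroup of index two and order `2 ^ n`, laws that are uniform on both cosets, and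
arbitrary laws on the subgroup, attain the closed form whenever the prescribed entropy `y` is at
least `n log 2`. -/
theorem exists_vecEntropy_eq_of_subgroup {G : Type*} [AddCommGroup G] [Fintype G]
    {H : AddSubgroup G} [Fintype H] {c : G} {n : ℕ} (hcard : Fintype.card H = 2 ^ n) (hc : c ∉ H)
    (hH : ∀ g ∉ H, g - c ∈ H) {x y : ℝ} (hx : x ∈ Icc 0 ((n + 1) * log 2))
    (hy : y ∈ Icc (n * log 2) ((n + 1) * log 2)) :
    ∃ p ∈ stdSimplex ℝ G, ∃ q ∈ stdSimplex ℝ G, vecEntropy p = x ∧ vecEntropy q = y ∧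
      vecEntropy (vecConv p q) = boxGerber x y := by
  have hunif := uniform_mem_stdSimplex (ι := H)
  have hlog : log (Fintype.card H) = n * log 2 := by rw [hcard]; push_cast; exact log_pow 2 n
  have eunif := (vecEntropy_uniform (ι := H)).trans hlog
  have he := add_self_mem hc hH
  obtain ⟨a', b', ha', hb', hab', e'⟩ := exists_negMulLog_add_eq (x := y - n * log 2)
    ⟨by linarith [hy.1], by linarith [hy.2]⟩
  obtain ⟨q, hq, hq₀, hq₁⟩ := exists_of_coset_split hc hH ha' hb' hab' hunif hunif
  have eq : vecEntropy q = y := by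
    rw [vecEntropy_eq_of_coset hc hH hunif hunif hq₀ hq₁, eunif, e', ← add_mul, hab']; ring
  -- The entropy of the sum depends only on the weights of the cosets.
  have key : ∀ {p : G → ℝ} {a b : ℝ} {v : H → ℝ}, 0 ≤ a → 0 ≤ b → a + b = 1 →
      v ∈ stdSimplex ℝ H → (∀ h : H, p h = a * v h) → (∀ h : H, p (c + h) = b * v h) →
      vecEntropy (vecConv p q) =
        n * log 2 + gerber (negMulLog a + negMulLog b) (y - n * log 2) := by
    intro p a b v ha hb hab hv hp₀ hp₁
    have h₀ := vecConv_coset_zero hc hH he hp₀ hp₁ hq₀ hq₁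
    have h₁ := vecConv_coset_one hc hH hp₀ hp₁ hq₀ hq₁
    simp only [vecConv_const hv, ← add_mul] at h₀ h₁
    rw [vecEntropy_eq_of_coset hc hH hunif hunif h₀ h₁, eunif, ← e',
      gerber_negMulLog ha hb hab ha' hb' hab', ← add_mul]
    have : a * a' + b * b' + (a * b' + b * a') = 1 := by
      have : a * a' + b * b' + (a * b' + b * a') = (a + b) * (a' + b') := by ring
      rw [this, hab, hab', one_mul]
    rw [this]; ring
  rcases le_total x (n * log 2) with h | h
  · obtain ⟨v, hv, ev⟩ := exists_entropy_eq H hx.1 (by rw [hlog]; exact h)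
    obtain ⟨p, hp, hp₀, hp₁⟩ := exists_of_coset_split hc hH zero_le_one le_rfl (add_zero 1) hv hv
    refine ⟨p, hp, q, hq, ?_, eq, ?_⟩
    · rw [vecEntropy_eq_of_coset hc hH hv hv hp₀ hp₁, ← ev]; simp [vecEntropy]
    · rw [key zero_le_one le_rfl (add_zero 1) hv hp₀ hp₁, negMulLog_one, negMulLog_zero, add_zero,
        gerber_zero_left ⟨by linarith [hy.1], by linarith [hy.2]⟩,
        boxGerber_of_le_of_le n (by exact_mod_cast h) (by exact_mod_cast hy.1)]
      ring
  · obtain ⟨a, b, ha, hb, hab, e⟩ := exists_negMulLog_add_eq (x := x - n * log 2)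
      ⟨by linarith, by linarith [hx.2]⟩
    obtain ⟨p, hp, hp₀, hp₁⟩ := exists_of_coset_split hc hH ha hb hab hunif hunif
    refine ⟨p, hp, q, hq, ?_, eq, ?_⟩
    · rw [vecEntropy_eq_of_coset hc hH hunif hunif hp₀ hp₁, eunif, e, ← add_mul, hab]; ring
    · rw [key ha hb hab hunif hp₀ hp₁, e, boxGerber_of_mem_closed_box (k := n)
        (by exact_mod_cast h) (by exact_mod_cast hx.2) (by exact_mod_cast hy.1)
        (by exact_mod_cast hy.2)]
      norm_cast

/-- The closed form is attained by independent summands. -/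
theorem exists_vecEntropy_eq_boxGerber (n : ℕ) : ∀ {G : Type u} [AddCommGroup G] [Fintype G],
    Fintype.card G = 2 ^ n → ∀ {x y : ℝ}, x ∈ Icc 0 (n * log 2) → y ∈ Icc 0 (n * log 2) →
      ∃ p ∈ stdSimplex ℝ G, ∃ q ∈ stdSimplex ℝ G, vecEntropy p = x ∧ vecEntropy q = y ∧
        vecEntropy (vecConv p q) = boxGerber x y := by
  induction n with
  | zero =>
    intro G _ _ hG x y hx hy
    have h0 : ∀ v ∈ stdSimplex ℝ G, vecEntropy v = 0 := fun v hv =>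
      le_antisymm (by simpa [hG] using vecEntropy_le_log_card hv) (vecEntropy_nonneg hv)
    simp only [Nat.cast_zero, zero_mul, Icc_self, mem_singleton_iff] at hx hy
    have hu := uniform_mem_stdSimplex (ι := G)
    refine ⟨_, hu, _, hu, by rw [h0 _ hu, hx], by rw [h0 _ hu, hy], ?_⟩
    rw [h0 _ (vecConv_mem hu hu), hx, hy, boxGerber_of_le_of_le 0 (by simp) (by simp)]
  | succ n ih =>
    intro G _ _ hG x y hx hy
    obtain ⟨H, c, hcard, hc, hH⟩ := exists_index_two (G := G) (by rw [Nat.card_eq_fintype_card, hG])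
    have := Fintype.ofFinite H
    rw [Nat.card_eq_fintype_card] at hcard
    push_cast at hx hy
    rcases le_total (n * log 2) y with h | h
    · exact exists_vecEntropy_eq_of_subgroup hcard hc hH hx ⟨h, hy.2⟩
    rcases le_total (n * log 2) x with h' | h'
    · obtain ⟨p, hp, q, hq, ep, eq, e⟩ :=
        exists_vecEntropy_eq_of_subgroup hcard hc hH hy ⟨h', hx.2⟩
      exact ⟨q, hq, p, hp, eq, ep, by rw [vecConv_comm, e, boxGerber_comm]⟩
    -- Otherwise both laws live on the subgroup.
    obtain ⟨v, hv, w, hw, ev, ew, e⟩ := ih hcard ⟨hx.1, h'⟩ ⟨hy.1, h⟩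
    obtain ⟨p, hp, hp₀, hp₁⟩ := exists_of_coset_split hc hH zero_le_one le_rfl (add_zero 1) hv hv
    obtain ⟨q, hq, hq₀, hq₁⟩ := exists_of_coset_split hc hH zero_le_one le_rfl (add_zero 1) hw hw
    refine ⟨p, hp, q, hq, ?_, ?_, ?_⟩
    · rw [vecEntropy_eq_of_coset hc hH hv hv hp₀ hp₁, ← ev]; simp
    · rw [vecEntropy_eq_of_coset hc hH hw hw hq₀ hq₁, ← ew]; simp
    · have h₀ := vecConv_coset_zero hc hH (add_self_mem hc hH) hp₀ hp₁ hq₀ hq₁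
      have h₁ := vecConv_coset_one hc hH hp₀ hp₁ hq₀ hq₁
      simp only [mul_one, mul_zero, zero_mul, add_zero] at h₀ h₁
      have hvw := vecConv_mem hv hw
      rw [vecEntropy_eq_of_coset (a := 1) (b := 0) hc hH hvw hvw (by simpa using h₀)
        (by simpa using h₁), ← e]
      simp

theorem fG_le_boxGerber {G : Type*} [AddCommGroup G] [Fintype G] [MeasurableSpace G]
    [DiscreteMeasurableSpace G] {n : ℕ} (hG : Fintype.card G = 2 ^ n) {x y : ℝ}
    (hx : x ∈ Icc 0 (log (Fintype.card G))) (hy : y ∈ Icc 0 (log (Fintype.card G))) :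
    fG G x y ≤ boxGerber x y := by
  have hlog : log (Fintype.card G) = n * log 2 := by rw [hG]; push_cast; exact log_pow 2 n
  obtain ⟨p, hp, q, hq, ep, eq, e⟩ := exists_vecEntropy_eq_boxGerber n hG (x := x)
    (y := y) (by rwa [← hlog]) (by rwa [← hlog])
  have := ofVec_prob hp
  have := ofVec_prob hq
  refine (fG_isLeast hx.1 hx.2 hy.1 hy.2).2 ⟨ofVec p, ofVec q, ‹_›, ‹_›, ?_, ?_, ?_⟩
  · simp only [measureEntropy, ofVec_real hp]; exact ep
  · simp only [measureEntropy, ofVec_real hq]; exact eq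
  · simp only [measureEntropy, conv_real, ofVec_real hp, ofVec_real hq]; exact e

/-! ### Conditioning -/

section Measure

variable {G : Type*} [Fintype G] [MeasurableSpace G] [DiscreteMeasurableSpace G]

theorem measureEntropy_mem (p : Measure G) [IsProbabilityMeasure p] :
    measureEntropy p ∈ Icc 0 (log (Fintype.card G)) := by
  have : Nonempty G := nonempty_of_isProbabilityMeasure p
  exact ⟨vecEntropy_nonneg (real_mem_stdSimplex p), vecEntropy_le_log_card (real_mem_stdSimplex p)⟩

theorem boxGerber_le_measureEntropy_conv [AddCommGroup G] {n : ℕ} (hG : Fintype.card G = 2 ^ n)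
    (p q : Measure G) [IsProbabilityMeasure p] [IsProbabilityMeasure q] :
    boxGerber (measureEntropy p) (measureEntropy q) ≤ measureEntropy (p.conv q) := by
  have e : measureEntropy (p.conv q) =
      vecEntropy (vecConv (fun g => p.real {g}) fun g => q.real {g}) := by
    simp only [measureEntropy, conv_real]
    rfl
  rw [e]
  exact boxGerber_le_vecEntropy n hG _ (real_mem_stdSimplex p) _ (real_mem_stdSimplex q)

theorem integrable_measureEntropy {𝒰 : Type*} [MeasurableSpace 𝒰] (κ : Kernel 𝒰 G)
    [IsMarkovKernel κ] (P : Measure 𝒰) [IsFiniteMeasure P] :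
    Integrable (fun u => measureEntropy (κ u)) P := by
  refine Integrable.of_mem_Icc 0 (log (Fintype.card G)) ?_
    (Filter.Eventually.of_forall fun u => measureEntropy_mem _)
  refine Measurable.aemeasurable (Finset.measurable_sum _ fun g _ => ?_)
  exact continuous_negMulLog.measurable.comp
    (κ.measurable_coe (MeasurableSet.of_discrete (s := {g}))).ennreal_toReal

/-- Given `U = u`, the law of `X + Z` is the convolution of the conditional law of `X` with the law
of `Z`, when `Z` is independent of `(U, X)`. -/
theorem condDistrib_add_ae_eq {Ω 𝒰 : Type*} [MeasurableSpace Ω] (μ : Measure Ω)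
    [IsProbabilityMeasure μ] [MeasurableSpace 𝒰] [AddCommGroup G] {X Z : Ω → G} {U : Ω → 𝒰}
    (hX : Measurable X) (hZ : Measurable Z) (hU : Measurable U)
    (hindep : IndepFun Z (fun ω => (U ω, X ω)) μ) :
    ∀ᵐ u ∂(μ.map U), condDistrib (fun ω => X ω + Z ω) U μ u =
      (condDistrib X U μ u).conv (μ.map Z) := by
  have hadd : Measurable fun p : G × G => p.1 + p.2 := .of_discrete
  have hY : Measurable fun ω => X ω + Z ω := hadd.comp (hX.prodMk hZ)
  have := Measure.isProbabilityMeasure_map (μ := μ) hZ.aemeasurable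
  have h := condDistrib_ae_eq_of_measure_eq_compProd (μ := μ) U hY.aemeasurable
    (κ := (condDistrib X U μ ×ₖ Kernel.const 𝒰 (μ.map Z)).map fun p => p.1 + p.2) ?_
  · filter_upwards [h] with u hu
    rw [hu, Kernel.map_apply _ hadd, Kernel.prod_apply, Kernel.const_apply]
    rfl
  have hlaw : μ.map (fun ω => ((U ω, X ω), Z ω)) =
      (μ.map U ⊗ₘ condDistrib X U μ).prod (μ.map Z) := by
    rw [compProd_map_condDistrib hX.aemeasurable]
    exact (indepFun_iff_map_prod_eq_prod_map_map (hU.prodMk hX).aemeasurable hZ.aemeasurable).1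
      hindep.symm
  refine Measure.ext_of_lintegral _ fun f hf => ?_
  have hf' : Measurable fun p : (𝒰 × G) × G => f (p.1.1, p.1.2 + p.2) :=
    hf.comp (measurable_fst.fst.prodMk (hadd.comp (measurable_fst.snd.prodMk measurable_snd)))
  calc ∫⁻ a, f a ∂(μ.map fun ω => (U ω, X ω + Z ω))
      = ∫⁻ p, f (p.1.1, p.1.2 + p.2) ∂(μ.map fun ω => ((U ω, X ω), Z ω)) := by
        rw [lintegral_map hf (hU.prodMk hY), lintegral_map hf' ((hU.prodMk hX).prodMk hZ)]
    _ = ∫⁻ u, ∫⁻ x, ∫⁻ z, f (u, x + z) ∂(μ.map Z) ∂(condDistrib X U μ u) ∂(μ.map U) := by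
        rw [hlaw, lintegral_prod _ hf'.aemeasurable,
          Measure.lintegral_compProd hf'.lintegral_prod_right']
    _ = _ := by
        rw [Measure.lintegral_compProd hf]
        refine lintegral_congr fun u => ?_
        rw [Kernel.map_apply _ hadd, lintegral_map (f := fun b => f (u, b)) .of_discrete hadd,
          Kernel.prod_apply, Kernel.const_apply, lintegral_prod]
        exact (Measurable.of_discrete).aemeasurable

end Measure

end ScalarMGL

theorem claim6p1 {Ω 𝒰 G : Type*} [MeasurableSpace Ω] (μ : Measure Ω) [IsProbabilityMeasure μ]
    [MeasurableSpace 𝒰] [AddCommGroup G] [Fintype G] [MeasurableSpace G]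
    [DiscreteMeasurableSpace G] (n : ℕ) (hG : Fintype.card G = 2 ^ n)
    (X Y Z : Ω → G) (U : Ω → 𝒰) (hX : Measurable X) (hZ : Measurable Z) (hU : Measurable U)
    (hindep : IndepFun Z (fun ω => (U ω, X ω)) μ) (hY : ∀ ω, Y ω = X ω + Z ω) :
    ScalarMGL.fG G (ScalarMGL.condEntropy X U μ) (ScalarMGL.entropy Z μ) ≤
      ScalarMGL.condEntropy Y U μ := by
  open ScalarMGL in
  obtain rfl : Y = fun ω => X ω + Z ω := funext hY
  have := Measure.isProbabilityMeasure_map (μ := μ) hZ.aemeasurable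
  have := Measure.isProbabilityMeasure_map (μ := μ) hU.aemeasurable
  have hint := integrable_measureEntropy (condDistrib X U μ) (μ.map U)
  have hx : condEntropy X U μ ∈ Set.Icc 0 (Real.log (Fintype.card G)) := by
    refine ⟨integral_nonneg fun u => (measureEntropy_mem _).1, ?_⟩
    calc condEntropy X U μ ≤ ∫ _, Real.log (Fintype.card G) ∂(μ.map U) :=
          integral_mono hint (integrable_const _) fun u => (measureEntropy_mem _).2
      _ = _ := by simp
  refine (fG_le_boxGerber hG hx (measureEntropy_mem (μ.map Z))).trans ?_
  obtain ⟨m, hm⟩ := boxGerber_support (condEntropy X U μ) (measureEntropy (μ.map Z))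
  have hint' : Integrable
      (fun u => m * (measureEntropy (condDistrib X U μ u) - condEntropy X U μ)) (μ.map U) :=
    (hint.sub (integrable_const _)).const_mul m
  -- Jensen's inequality: integrate the supporting line of the closed form at `H(X|U)`.
  calc boxGerber (condEntropy X U μ) (measureEntropy (μ.map Z))
      = ∫ u, (boxGerber (condEntropy X U μ) (measureEntropy (μ.map Z)) +
          m * (measureEntropy (condDistrib X U μ u) - condEntropy X U μ)) ∂(μ.map U) := by
        rw [integral_add (integrable_const _) hint', integral_const_mul,
          integral_sub hint (integrable_const _)]
        simp [condEntropy]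
    _ ≤ condEntropy (fun ω => X ω + Z ω) U μ := by
        refine integral_mono_ae ((integrable_const _).add hint')
          (integrable_measureEntropy _ _) ?_
        filter_upwards [condDistrib_add_ae_eq μ hX hZ hU hindep] with u hu
        rw [hu]
        exact (hm _).trans (boxGerber_le_measureEntropy_conv hG _ _)
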